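/- Let $G$ be a compact connected Lie group with Lie algebra $\mathfrak g$, let $(\cdot,\cdot)$ be an $\mathrm{Ad}$-invariant inner product on $\mathfrak g$, let $\Lambda\in\mathfrak g$, and let $O(\Lambda)=\{\mathrm{Ad}(g)\Lambda : g\in G\}$ be the adjoint orbit, with the Kirillov–Kostant–Souriau symplectic form $\omega_Z([X,Z],[Y,Z])=-(Z,[X,Y])$ for $Z\in O(\Lambda)$, $X,Y\in\mathfrak g$. For a smooth function $f$ on an open subset of $O(\Lambda)$ let $X_f$ be its Hamiltonian vector field, $df+\iota_{X_f}\omega=0$, and put $\{f,h\}=\omega(X_f,X_h)$. Let $G=K_0\supset K_1\supset\cdots\supset K_s$ be a chain of closed connected Lie subgroups with Lie algebras $\mathfrak k_i\subset\mathfrak g$. Let $\Phi_i\colon O(\Lambda)\to\mathfrak k_i$ be the moment map of the restricted adjoint action of $K_i$ on $O(\Lambda)$, that is, the restriction to $O(\Lambda)$ of the orthogonal projection $\mathfrak g\to\mathfrak k_i$, and let $\pi^i_s\colon\mathfrak k_i\to\mathfrak k_s$ be the orthogonal projection. Let $F\in C^\infty(\mathfrak k_s)$ and $H=\Phi_s^*(F)=F\circ\Phi_s$.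 Then the following hold, where $\frac{d}{dt}$ is the derivative along any solution $\gamma$ of the Hamiltonian equation of motion $\gamma'(t)=X_H(\gamma(t))$ in $O(\Lambda)$. 1. For every $i=1,\dots,s$, the maps $L_i=\Phi_i$ and $P_i=\nabla(F\circ\pi^i_s)(\Phi_i)$ from $O(\Lambda)$ to $\mathfrak k_i$ are smooth and satisfy the Lax equation $$\frac{d}{dt}L_i+[L_i,P_i]=0 .$$ 2. Let $\varrho=(\varrho_1,\dots,\varrho_s)$, where $\varrho_i\colon K_i\to \mathrm{GL}(V_i)$ is an irreducible unitary representation of the Lie group $K_i$ on a finite-dimensional complex inner product space $V_i$, with induced Lie algebra representation $(\varrho_i)_*\colon \mathfrak k_i\to\mathfrak{gl}(V_i)$. There are $r\in\mathbb N$ and smooth maps $L_\varrho,P_\varrho\colon O(\Lambda)\to\mathfrak{gl}(r,\mathbb R)$, namely the matrices of $\bigoplus_{i=1}^s(\varrho_i)_*(L_i)$ and $\bigoplus_{i=1}^s(\varrho_i)_*(P_i)$ in some basis of the real vector space underlying $\bigoplus_{i=1}^s V_i$, such that $$\frac{d}{dt}L_\varrho+[L_\varrho,P_\varrho]=0 .$$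 Moreover, there are an open dense subset $\mathcal U_\Lambda\subset O(\Lambda)$ and functions $\mu_1,\dots,\mu_r\in C^\infty(\mathcal U_\Lambda)$ such that, for every $Z\in\mathcal U_\Lambda$, the complex eigenvalues of $L_\varrho(Z)$, counted with algebraic multiplicity, are $\sqrt{-1}\,\mu_1(Z),\dots,\sqrt{-1}\,\mu_r(Z)$, and such that $\{H,\mu_j\}=0$ and $\{\mu_j,\mu_l\}=0$ on $\mathcal U_\Lambda$ for all $j,l\in\{1,\dots,r\}$. -/

import Mathlib

open scoped Manifold ContDiff

noncomputable section

namespace GelfandTsetlinLax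

/-! ### Lie groups, adjoint action, invariant inner products

A finite-dimensional Lie group is a group `G` which is a smooth manifold modelled on a
finite-dimensional real vector space `E`; its Lie algebra is the tangent space at the identity with
the bracket of left-invariant vector fields. -/

/-- The Lie algebra of the Lie group `G` modelled on `E`. As a topological vector space it is
definitionally equal to `E`. -/
abbrev LieAlg (E : Type*) [NormedAddCommGroup E] [NormedSpace ℝ E]
    (G : Type*) [TopologicalSpace G] [ChartedSpace E G] [Group G] : Type _ :=
  GroupLieAlgebra 𝓘(ℝ, E) G

section Group

variable {E : Type*} [NormedAddCommGroup E] [NormedSpace ℝ E]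
  {G : Type*} [TopologicalSpace G] [ChartedSpace E G] [Group G]

/-- The adjoint action: `Ad g` is the differential at `1` of `h ↦ g h g⁻¹`. -/
def Ad (g : G) : LieAlg E G →L[ℝ] LieAlg E G :=
  (mfderiv 𝓘(ℝ, E) 𝓘(ℝ, E) (fun h : G => g * h * g⁻¹) (1 : G) : E →L[ℝ] E)

/-- `Ad (g h) = Ad g ∘ Ad h`. -/
theorem Ad_mul [LieGroup 𝓘(ℝ, E) ∞ G] (g h : G) (X : LieAlg E G) :
    Ad (g * h) X = Ad g (Ad h X) := by
  have hd : ∀ (a x : G), MDifferentiableAt 𝓘(ℝ, E) 𝓘(ℝ, E) (fun y : G => a * y * a⁻¹) x := by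
    intro a x
    have h1 : ContMDiff 𝓘(ℝ, E) 𝓘(ℝ, E) ∞ (fun y : G => a * y * a⁻¹) :=
      (contMDiff_mul_right (a := a⁻¹)).comp (contMDiff_mul_left (a := a))
    exact h1.mdifferentiableAt (by simp)
  have hc : (fun y : G => (g * h) * y * (g * h)⁻¹) =
      (fun y : G => g * y * g⁻¹) ∘ (fun y : G => h * y * h⁻¹) := by
    funext y
    simp [mul_assoc]
  have h1 : h * 1 * h⁻¹ = 1 := by simp
  have key := mfderiv_comp (I := 𝓘(ℝ, E)) (I' := 𝓘(ℝ, E)) (I'' := 𝓘(ℝ, E)) (1 : G)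
    (hd g (h * 1 * h⁻¹)) (hd h 1)
  rw [← hc, h1] at key
  exact congrArg (fun T : E →L[ℝ] E => T X) key

/-- `B` is an `Ad`-invariant inner product on the Lie algebra of `G`. -/
structure IsAdInvariantInner (B : LinearMap.BilinForm ℝ (LieAlg E G)) : Prop where
  symm : ∀ X Y, B X Y = B Y X
  pos : ∀ X, X ≠ 0 → 0 < B X X
  invariant : ∀ (g : G) (X Y : LieAlg E G), B (Ad g X) (Ad g Y) = B X Y

/-! ### The adjoint orbit as a symplectic manifold

The orbit `O(Λ)` is the homogeneous space of the (transitive) `G`-action `Ad`. A function on it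
is smooth iff its pull-back along the orbit map `g ↦ Ad g Λ`, which is a surjective submersion,
is smooth. The tangent space at `Z` consists of the vectors `⁅X, Z⁆`, the velocity of
`t ↦ Ad (exp (tX)) Z` at `t = 0`. -/

/-- The adjoint orbit `O(Λ) = {Ad g Λ | g ∈ G}`. -/
def adjointOrbit (Λ : LieAlg E G) : Set (LieAlg E G) :=
  Set.range fun g : G => Ad g Λ

variable {Λ : LieAlg E G}

/-- The orbit map `g ↦ Ad g Λ`. -/
def orbitMap (Λ : LieAlg E G) (g : G) : adjointOrbit Λ := ⟨Ad g Λ, g, rfl⟩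

/-- The action of `G` on the orbit. -/
def orbitAct [LieGroup 𝓘(ℝ, E) ∞ G] (g : G) (Z : adjointOrbit Λ) : adjointOrbit Λ :=
  ⟨Ad g Z.1, by
    obtain ⟨Z, h, rfl⟩ := Z
    exact ⟨g * h, Ad_mul g h Λ⟩⟩

/-- A function on the orbit with values in a normed space is smooth on the open set `U`. -/
def SmoothOnOrbit {W : Type*} [NormedAddCommGroup W] [NormedSpace ℝ W]
    (f : adjointOrbit Λ → W) (U : Set (adjointOrbit Λ)) : Prop :=
  ContMDiffOn 𝓘(ℝ, E) 𝓘(ℝ, W) ∞ (fun g : G => f (orbitMap Λ g)) (orbitMap Λ ⁻¹' U)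

/-- Some `X` with `⁅X, Z⁆ = v`, for a vector `v` tangent to the orbit at `Z`. -/
def lift (Z : adjointOrbit Λ) (v : LieAlg E G) : LieAlg E G :=
  Classical.epsilon fun X : LieAlg E G => ⁅X, Z.1⁆ = v

/-- The differential at `Z` of a real function on the orbit: on the tangent vector `v = ⁅X, Z⁆`
it is the derivative at `1` of `g ↦ f (Ad g Z)` in the direction `X` (which depends on `v` only,
when `f` is smooth near `Z`). -/
def orbitDiff [LieGroup 𝓘(ℝ, E) ∞ G] (f : adjointOrbit Λ → ℝ) (Z : adjointOrbit Λ)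
    (v : LieAlg E G) : ℝ :=
  (mfderiv 𝓘(ℝ, E) 𝓘(ℝ, ℝ) (fun g : G => f (orbitAct g Z)) (1 : G) : E →L[ℝ] ℝ) (lift Z v)

/-- The Kirillov-Kostant-Souriau form: `ω_Z(⁅X, Z⁆, ⁅Y, Z⁆) = - (Z, ⁅X, Y⁆)` (this depends on
`⁅X, Z⁆` and `⁅Y, Z⁆` only, by invariance of the inner product). -/
def kksForm (B : LinearMap.BilinForm ℝ (LieAlg E G)) (Z : adjointOrbit Λ)
    (v w : LieAlg E G) : ℝ :=
  - B Z.1 ⁅lift Z v, lift Z w⁆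

/-- `v` is the value at `Z` of the Hamiltonian vector field of `f`: it is tangent to the orbit
and `df + ω(v, ·) = 0` on the tangent space at `Z`. -/
def IsHamiltonianVector [LieGroup 𝓘(ℝ, E) ∞ G] (B : LinearMap.BilinForm ℝ (LieAlg E G))
    (f : adjointOrbit Λ → ℝ) (Z : adjointOrbit Λ) (v : LieAlg E G) : Prop :=
  (∃ X : LieAlg E G, ⁅X, Z.1⁆ = v) ∧
    ∀ Y : LieAlg E G, orbitDiff f Z ⁅Y, Z.1⁆ + kksForm B Z v ⁅Y, Z.1⁆ = 0

/-- The Hamiltonian vector field `X_f`: the vector determined by the previous condition, which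
exists and is unique at every point near which `f` is smooth. -/
def hamiltonianVectorField [LieGroup 𝓘(ℝ, E) ∞ G] (B : LinearMap.BilinForm ℝ (LieAlg E G))
    (f : adjointOrbit Λ → ℝ) (Z : adjointOrbit Λ) : LieAlg E G :=
  Classical.epsilon (IsHamiltonianVector B f Z)

/-- The Poisson bracket `{f, h} = ω(X_f, X_h)`. -/
def poissonBracket [LieGroup 𝓘(ℝ, E) ∞ G] (B : LinearMap.BilinForm ℝ (LieAlg E G))
    (f h : adjointOrbit Λ → ℝ) (Z : adjointOrbit Λ) : ℝ :=
  kksForm B Z (hamiltonianVectorField B f Z) (hamiltonianVectorField B h Z)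

/-- `γ` solves, at all times in `J`, the Hamiltonian equation of motion
`γ'(t) = X_H(γ(t))`. -/
def IsTrajectoryOn [LieGroup 𝓘(ℝ, E) ∞ G] (B : LinearMap.BilinForm ℝ (LieAlg E G))
    (H : adjointOrbit Λ → ℝ) (γ : ℝ → adjointOrbit Λ) (J : Set ℝ) : Prop :=
  ∀ t ∈ J, HasDerivAt (fun τ => (γ τ).1) (hamiltonianVectorField B H (γ t)) t

/-! ### Lie subgroups, projections, moment maps, gradients

The Lie algebra of a Lie subgroup `K` is regarded as a subspace of that of `G` through the
differential of the inclusion, and it carries the restricted inner product. -/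

variable {E' : Type*} [NormedAddCommGroup E'] [NormedSpace ℝ E']

/-- The differential at `1` of the inclusion `K → G`. -/
def lieIncl (K : Subgroup G) [ChartedSpace E' K] : LieAlg E' K →L[ℝ] LieAlg E G :=
  (mfderiv 𝓘(ℝ, E') 𝓘(ℝ, E) (Subtype.val : K → G) (1 : K) : E' →L[ℝ] E)

/-- The orthogonal projection from the Lie algebra of `G` to that of `K`. -/
def proj (B : LinearMap.BilinForm ℝ (LieAlg E G)) (K : Subgroup G) [ChartedSpace E' K]
    (Z : LieAlg E G) : LieAlg E' K :=
  Classical.epsilon fun v : LieAlg E' K =>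
    ∀ w : LieAlg E' K, B (lieIncl K v) (lieIncl K w) = B Z (lieIncl K w)

/-- The moment map `Φ_K` on the orbit of the action of `K`: the inclusion of the orbit followed by
the orthogonal projection. -/
def momentMap (B : LinearMap.BilinForm ℝ (LieAlg E G)) (K : Subgroup G) [ChartedSpace E' K]
    (Z : adjointOrbit Λ) : LieAlg E' K :=
  proj B K Z.1

/-- The gradient of a function on the Lie algebra of `K`, for the restricted inner product. -/
def grad (B : LinearMap.BilinForm ℝ (LieAlg E G)) (K : Subgroup G) [ChartedSpace E' K]
    (F : LieAlg E' K → ℝ) (Y : LieAlg E' K) : LieAlg E' K :=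
  Classical.epsilon fun v : LieAlg E' K =>
    ∀ w : LieAlg E' K, B (lieIncl K v) (lieIncl K w) = fderiv ℝ (fun y : E' => F y) Y w

/-- For Lie subgroups `K' ⊆ K` the orthogonal projection from the Lie algebra of `K` to that
of `K'`. -/
def relProj {E'' : Type*} [NormedAddCommGroup E''] [NormedSpace ℝ E'']
    (B : LinearMap.BilinForm ℝ (LieAlg E G)) (K K' : Subgroup G)
    [ChartedSpace E' K] [ChartedSpace E'' K'] (Y : LieAlg E' K) : LieAlg E'' K' :=
  proj B K' (lieIncl K Y)

end Group

/-! ### Representations -/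

section Representation

variable {E : Type*} [NormedAddCommGroup E] [NormedSpace ℝ E]
  {K : Type*} [TopologicalSpace K] [ChartedSpace E K] [Group K]
  {V : Type*} [NormedAddCommGroup V] [InnerProductSpace ℂ V] [FiniteDimensional ℂ V]

/-- `ϱ` is an irreducible unitary representation of the Lie group `K`: a smooth homomorphism to
the unitary operators of a finite-dimensional complex inner product space, without proper
nonzero invariant subspaces. -/
structure IsIrreducibleUnitary (ϱ : Representation ℂ K V) : Prop where
  smooth : ContMDiff 𝓘(ℝ, E) 𝓘(ℝ, V →L[ℂ] V) ∞
    (fun k : K => LinearMap.toContinuousLinearMap (ϱ k))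
  unitary : ∀ (k : K) (v w : V), inner ℂ (ϱ k v) (ϱ k w) = inner ℂ v w
  irreducible : ϱ.IsIrreducible

/-- The induced representation `ϱ_*` of the Lie algebra: the differential of `ϱ` at `1`. -/
def inducedRep (ϱ : Representation ℂ K V) (X : LieAlg E K) : V →L[ℂ] V :=
  (mfderiv 𝓘(ℝ, E) 𝓘(ℝ, V →L[ℂ] V)
    (fun k : K => LinearMap.toContinuousLinearMap (ϱ k)) (1 : K) : E →L[ℝ] (V →L[ℂ] V)) X

/-- The direct sum of a family of complex operators, as a real linear operator. -/
def directSum {ι : Type*} {V : ι → Type*} [∀ i, NormedAddCommGroup (V i)]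
    [∀ i, InnerProductSpace ℂ (V i)] (T : ∀ i, V i →L[ℂ] V i) : (∀ i, V i) →ₗ[ℝ] (∀ i, V i) :=
  (LinearMap.pi fun i => (T i).toLinearMap ∘ₗ LinearMap.proj i :
    (∀ i, V i) →ₗ[ℂ] (∀ i, V i)).restrictScalars ℝ

end Representation

end GelfandTsetlinLax

end

/-! Invariance of the inner product makes `ad` skew, so ω_Z([X,Z],[Y,Z]) = ([X,Z],Y), and a function
on the orbit with ambient gradient `a` at Z has Hamiltonian vector [a,Z]
(`hamiltonianVectorField_eq`). For H = F ∘ Φ_s the vector `a` is the gradient of F at Φ_s(Z), which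
lies in 𝔨_s. The projection to 𝔨_i commutes with the action of 𝔨_i ⊇ 𝔨_s (`projL_adL`), hence Φ_i' =
[a, Φ_i] along a trajectory; and `a` is also the gradient of F ∘ π^i_s at Φ_i (`exists_grad_eq`).
This is the Lax equation, and the homomorphisms (ϱ_i)_* carry it to matrices.

For the spectrum, unitarity makes (ϱ_i)_*(Φ_i) skew-hermitian, with eigenvalues √-1 λ, λ real;
passing to the underlying real space adjoins -√-1 λ. The sorted λ are continuous by Weyl's
inequality. On the open dense set where their coincidences are locally constant, each λ is a simple
root of a derivative of the characteristic polynomial, so it is locally a smooth function of Φ_i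
(`exists_smooth_root`). Each λ is also K_i-invariant. If K' ≤ K, the Hamiltonian vector of a
function of Φ_{K'} is tangent to the K'-orbits and annihilates K-invariant functions
(`poissonBracket_eq_zero`). As the subgroups form a chain, this applies to H and μ_j, and to any μ_j
and μ_l.

All of this uses the bracket as the derivative of `Ad`, whereas it is defined by left-invariant
fields; `bracket_eq_adL` joins the two by a computation in the chart at 1. No manifold structure on
the orbit is needed: functions on it are written locally as functions on the ambient Lie algebra. -/

noncomputable section

namespace GelfandTsetlinLax

set_option linter.unusedSectionVars false

/-! ### Smoothness of `Ad`, and the Lie bracket as its differential -/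

section LieGroupBasics

open VectorField Set Filter Topology

variable {E : Type*} [NormedAddCommGroup E] [NormedSpace ℝ E]
  {G : Type*} [TopologicalSpace G] [ChartedSpace E G]

/-- The manifold derivative, as an operator between the model spaces. -/
def mder {F : Type*} [NormedAddCommGroup F] [NormedSpace ℝ F] {N : Type*} [TopologicalSpace N]
    [ChartedSpace F N] (f : G → N) (x : G) : E →L[ℝ] F :=
  mfderiv 𝓘(ℝ, E) 𝓘(ℝ, F) f x

theorem mder_comp {F F' : Type*} [NormedAddCommGroup F] [NormedSpace ℝ F]
    [NormedAddCommGroup F'] [NormedSpace ℝ F'] {N N' : Type*} [TopologicalSpace N]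
    [ChartedSpace F N] [TopologicalSpace N'] [ChartedSpace F' N'] {g : N → N'} {f : G → N} (x : G)
    (hg : MDifferentiableAt 𝓘(ℝ, F) 𝓘(ℝ, F') g (f x))
    (hf : MDifferentiableAt 𝓘(ℝ, E) 𝓘(ℝ, F) f x) :
    (mder (g ∘ f) x : E →L[ℝ] F') = (mder g (f x) : F →L[ℝ] F').comp (mder f x) :=
  mfderiv_comp x hg hf

theorem mder_eq_fderiv {F : Type*} [NormedAddCommGroup F] [NormedSpace ℝ F]
    {f : G → F} {x : G} (hf : MDifferentiableAt 𝓘(ℝ, E) 𝓘(ℝ, F) f x) :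
    (mder f x : E →L[ℝ] F) =
      fderiv ℝ (f ∘ (extChartAt 𝓘(ℝ, E) x).symm) (extChartAt 𝓘(ℝ, E) x x) := by
  rw [mder, hf.mfderiv, ModelWithCorners.range_eq_univ, fderivWithin_univ]
  rfl

theorem mder_id (x : G) : (mder (id : G → G) x : E →L[ℝ] E) = ContinuousLinearMap.id ℝ E :=
  mfderiv_id

theorem mder_vector {F : Type*} [NormedAddCommGroup F] [NormedSpace ℝ F] (f : E → F) (x : E) :
    mder f x = fderiv ℝ f x :=
  mfderiv_eq_fderiv

theorem mder_congr {F : Type*} [NormedAddCommGroup F] [NormedSpace ℝ F] {N : Type*}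
    [TopologicalSpace N] [ChartedSpace F N] {f g : G → N} {x : G} (h : f =ᶠ[𝓝 x] g) :
    (mder f x : E →L[ℝ] F) = mder g x :=
  h.mfderiv_eq

variable [Group G]

/-- The adjoint action, as a map to the normed space of operators of the model space. -/
def AdL (g : G) : E →L[ℝ] E := Ad g

variable (E G) in
theorem AdL_one : (AdL (1 : G) : E →L[ℝ] E) = ContinuousLinearMap.id ℝ E := by
  have : (fun h : G => 1 * h * 1⁻¹) = id := by
    funext h
    simp
  change mder (fun h : G => 1 * h * 1⁻¹) 1 = _
  rw [this, mder_id]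

variable [LieGroup 𝓘(ℝ, E) ∞ G] in
theorem conj_mdifferentiable (g : G) :
    MDifferentiable 𝓘(ℝ, E) 𝓘(ℝ, E) (fun h : G => g * h * g⁻¹) := by
  have h1 : ContMDiff 𝓘(ℝ, E) 𝓘(ℝ, E) ∞ (fun y : G => g * y * g⁻¹) :=
    (contMDiff_mul_right (a := g⁻¹)).comp (contMDiff_mul_left (a := g))
  exact h1.mdifferentiable (by simp)

/-- Multiplication read in the chart at the identity. -/
def chartMul (E : Type*) [NormedAddCommGroup E] [NormedSpace ℝ E]
    (G : Type*) [TopologicalSpace G] [ChartedSpace E G] [Group G] (x y : E) : E :=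
  extChartAt 𝓘(ℝ, E) (1 : G)
    ((extChartAt 𝓘(ℝ, E) (1 : G)).symm x * (extChartAt 𝓘(ℝ, E) (1 : G)).symm y)

/-- The identity read in the chart at the identity. -/
def chartOne (E : Type*) [NormedAddCommGroup E] [NormedSpace ℝ E]
    (G : Type*) [TopologicalSpace G] [ChartedSpace E G] [Group G] : E :=
  extChartAt 𝓘(ℝ, E) (1 : G) (1 : G)

theorem extChartAt_symm_chartOne :
    (extChartAt 𝓘(ℝ, E) (1 : G)).symm (chartOne E G) = 1 :=
  extChartAt_to_inv (I := 𝓘(ℝ, E)) (1 : G)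

theorem eventually_chart_leftInverse :
    ∀ᶠ x in 𝓝 (chartOne E G), extChartAt 𝓘(ℝ, E) (1 : G)
      ((extChartAt 𝓘(ℝ, E) (1 : G)).symm x) = x := by
  filter_upwards [extChartAt_target_mem_nhds (I := 𝓘(ℝ, E)) (1 : G)] with x hx
  exact (extChartAt 𝓘(ℝ, E) (1 : G)).right_inv hx

/-- The differential of left translation, read in the chart at the identity. -/
def chartLeft (E : Type*) [NormedAddCommGroup E] [NormedSpace ℝ E]
    (G : Type*) [TopologicalSpace G] [ChartedSpace E G] [Group G] (x : E) : E →L[ℝ] E :=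
  fderiv ℝ (fun y => chartMul E G x y) (chartOne E G)

/-- The differential of right translation, read in the chart at the identity. -/
def chartRight (E : Type*) [NormedAddCommGroup E] [NormedSpace ℝ E]
    (G : Type*) [TopologicalSpace G] [ChartedSpace E G] [Group G] (x : E) : E →L[ℝ] E :=
  fderiv ℝ (fun y => chartMul E G y x) (chartOne E G)

theorem chartLeft_one : chartLeft E G (chartOne E G) = ContinuousLinearMap.id ℝ E := by
  have : (fun y => chartMul E G (chartOne E G) y) =ᶠ[𝓝 (chartOne E G)] id := by
    filter_upwards [eventually_chart_leftInverse (E := E) (G := G)] with x hx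
    rw [chartMul, extChartAt_symm_chartOne, one_mul, hx, id]
  rw [chartLeft, this.fderiv_eq, fderiv_id]

theorem chartRight_one : chartRight E G (chartOne E G) = ContinuousLinearMap.id ℝ E := by
  have : (fun y => chartMul E G y (chartOne E G)) =ᶠ[𝓝 (chartOne E G)] id := by
    filter_upwards [eventually_chart_leftInverse (E := E) (G := G)] with x hx
    rw [chartMul, extChartAt_symm_chartOne, mul_one, hx, id]
  rw [chartRight, this.fderiv_eq, fderiv_id]

variable [LieGroup 𝓘(ℝ, E) ∞ G]

theorem contDiffAt_chartMul :
    ContDiffAt ℝ ∞ (Function.uncurry (chartMul E G)) (chartOne E G, chartOne E G) := by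
  rw [← contMDiffAt_iff_contDiffAt]
  have hs : ContMDiffAt 𝓘(ℝ, E) 𝓘(ℝ, E) ∞ (extChartAt 𝓘(ℝ, E) (1 : G)).symm (chartOne E G) :=
    (contMDiffOn_extChartAt_symm (1 : G)).contMDiffAt (extChartAt_target_mem_nhds (1 : G))
  have hm : ContMDiffAt 𝓘(ℝ, E × E) 𝓘(ℝ, E) ∞ (fun z : E × E =>
      (extChartAt 𝓘(ℝ, E) (1 : G)).symm z.1 * (extChartAt 𝓘(ℝ, E) (1 : G)).symm z.2)
      (chartOne E G, chartOne E G) := by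
    refine ContMDiffAt.mul (ContMDiffAt.comp _ (by exact hs) ?_) (ContMDiffAt.comp _ (by exact hs) ?_)
    · exact contDiff_fst.contMDiff.contMDiffAt
    · exact contDiff_snd.contMDiff.contMDiffAt
  refine ContMDiffAt.comp _ ?_ hm
  have : (extChartAt 𝓘(ℝ, E) (1 : G)).symm (chartOne E G) *
      (extChartAt 𝓘(ℝ, E) (1 : G)).symm (chartOne E G) = 1 := by
    rw [extChartAt_symm_chartOne, one_mul]
  simp only [this]
  exact contMDiffAt_extChartAt

theorem contDiffAt_chartLeft : ContDiffAt ℝ ∞ (chartLeft E G) (chartOne E G) :=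
  ContDiffAt.fderiv (f := chartMul E G) (g := fun _ => chartOne E G) contDiffAt_chartMul
    contDiffAt_const (le_refl _)

theorem contDiffAt_chartRight : ContDiffAt ℝ ∞ (chartRight E G) (chartOne E G) :=
  ContDiffAt.fderiv (f := fun x y => chartMul E G y x) (g := fun _ => chartOne E G)
    (ContDiffAt.comp (f := fun z : E × E => (z.2, z.1)) (chartOne E G, chartOne E G)
      contDiffAt_chartMul (contDiffAt_snd.prodMk contDiffAt_fst))
    contDiffAt_const (le_refl _)

/-- Equality of mixed second derivatives of the multiplication. -/
theorem fderiv_chartRight_apply (X Y : E) :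
    fderiv ℝ (chartRight E G) (chartOne E G) X Y = fderiv ℝ (chartLeft E G) (chartOne E G) Y X := by
  set p := chartOne E G
  set m := Function.uncurry (chartMul E G) with hm
  have hc : ContDiffAt ℝ ∞ m (p, p) := contDiffAt_chartMul
  have hev : ∀ᶠ z in 𝓝 (p, p), DifferentiableAt ℝ m z :=
    ((hc.of_le (m := 1) (by norm_cast)).eventually (by simp)).mono
      fun z hz => hz.differentiableAt (by simp)
  have hD : DifferentiableAt ℝ (fderiv ℝ m) (p, p) :=
    (hc.fderiv_right (m := ∞) (le_refl _)).differentiableAt (by simp)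
  have hl : (chartLeft E G) =ᶠ[𝓝 p] fun x => (fderiv ℝ m (x, p)).comp
      (ContinuousLinearMap.inr ℝ E E) := by
    have : Tendsto (fun x : E => (x, p)) (𝓝 p) (𝓝 (p, p)) :=
      (continuous_id.prodMk continuous_const).tendsto' _ _ rfl
    filter_upwards [this.eventually hev] with x hx
    exact (HasFDerivAt.comp (f := fun y => (x, y)) p hx.hasFDerivAt (hasFDerivAt_prodMk_right x p)).fderiv
  have hr : (chartRight E G) =ᶠ[𝓝 p] fun x => (fderiv ℝ m (p, x)).comp
      (ContinuousLinearMap.inl ℝ E E) := by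
    have : Tendsto (fun x : E => (p, x)) (𝓝 p) (𝓝 (p, p)) :=
      (continuous_const.prodMk continuous_id).tendsto' _ _ rfl
    filter_upwards [this.eventually hev] with x hx
    exact (HasFDerivAt.comp (f := fun y => (y, x)) p hx.hasFDerivAt (hasFDerivAt_prodMk_left p x)).fderiv
  have h1 : ∀ v w, fderiv ℝ (chartLeft E G) p v w = fderiv ℝ (fderiv ℝ m) (p, p) (v, 0) (0, w) := by
    intro v w
    rw [hl.fderiv_eq]
    have := ((HasFDerivAt.comp (f := fun y => (y, p)) p hD.hasFDerivAt (hasFDerivAt_prodMk_left p p)).clm_comp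
      (hasFDerivAt_const (ContinuousLinearMap.inr ℝ E E) p)).fderiv
    erw [this]
    simp
  have h2 : ∀ v w, fderiv ℝ (chartRight E G) p v w =
      fderiv ℝ (fderiv ℝ m) (p, p) (0, v) (w, 0) := by
    intro v w
    rw [hr.fderiv_eq]
    have := ((HasFDerivAt.comp (f := fun y => (p, y)) p hD.hasFDerivAt (hasFDerivAt_prodMk_right p p)).clm_comp
      (hasFDerivAt_const (ContinuousLinearMap.inl ℝ E E) p)).fderiv
    erw [this]
    simp
  rw [h1, h2]
  exact (hc.isSymmSndFDerivAt (by simp; norm_cast)) _ _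

theorem mder_chart_mul_left {x : E} (hx : x ∈ (extChartAt 𝓘(ℝ, E) (1 : G)).target) :
    (mder (extChartAt 𝓘(ℝ, E) (1 : G)) ((extChartAt 𝓘(ℝ, E) (1 : G)).symm x) : E →L[ℝ] E).comp
      (mder (fun h : G => (extChartAt 𝓘(ℝ, E) (1 : G)).symm x * h) 1) = chartLeft E G x := by
  set g := (extChartAt 𝓘(ℝ, E) (1 : G)).symm x with hg
  have hgs : g ∈ (chartAt E (1 : G)).source := by
    rw [← extChartAt_source 𝓘(ℝ, E)]
    exact (extChartAt 𝓘(ℝ, E) (1 : G)).map_target hx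
  have hd : MDifferentiableAt 𝓘(ℝ, E) 𝓘(ℝ, E) (fun h : G => g * h) 1 :=
    (contMDiff_mul_left (I := 𝓘(ℝ, E)) (n := ∞)).mdifferentiableAt (by simp)
  have hc : MDifferentiableAt 𝓘(ℝ, E) 𝓘(ℝ, E) (extChartAt 𝓘(ℝ, E) (1 : G)) (g * 1) := by
    rw [mul_one]
    exact mdifferentiableAt_extChartAt hgs
  have key := mder_comp (1 : G) hc hd
  rw [mder_eq_fderiv (hc.comp (1 : G) hd), mul_one] at key
  exact key.symm

theorem mder_chart_mul_right {x : E} (hx : x ∈ (extChartAt 𝓘(ℝ, E) (1 : G)).target) :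
    (mder (extChartAt 𝓘(ℝ, E) (1 : G)) ((extChartAt 𝓘(ℝ, E) (1 : G)).symm x) : E →L[ℝ] E).comp
      (mder (fun h : G => h * (extChartAt 𝓘(ℝ, E) (1 : G)).symm x) 1) = chartRight E G x := by
  set g := (extChartAt 𝓘(ℝ, E) (1 : G)).symm x with hg
  have hgs : g ∈ (chartAt E (1 : G)).source := by
    rw [← extChartAt_source 𝓘(ℝ, E)]
    exact (extChartAt 𝓘(ℝ, E) (1 : G)).map_target hx
  have hd : MDifferentiableAt 𝓘(ℝ, E) 𝓘(ℝ, E) (fun h : G => h * g) 1 :=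
    (contMDiff_mul_right (I := 𝓘(ℝ, E)) (n := ∞)).mdifferentiableAt (by simp)
  have hc : MDifferentiableAt 𝓘(ℝ, E) 𝓘(ℝ, E) (extChartAt 𝓘(ℝ, E) (1 : G)) (1 * g) := by
    rw [one_mul]
    exact mdifferentiableAt_extChartAt hgs
  have key := mder_comp (1 : G) hc hd
  rw [mder_eq_fderiv (hc.comp (1 : G) hd), one_mul] at key
  exact key.symm

theorem mder_mul_right_comp_AdL (g : G) :
    (mder (fun h : G => h * g) 1 : E →L[ℝ] E).comp (AdL g) = mder (fun h : G => g * h) 1 := by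
  have hd : MDifferentiable 𝓘(ℝ, E) 𝓘(ℝ, E) (fun h : G => h * g) :=
    (contMDiff_mul_right (I := 𝓘(ℝ, E)) (n := ∞)).mdifferentiable (by simp)
  have key := mder_comp (1 : G) (hd (g * 1 * g⁻¹)) (conj_mdifferentiable (E := E) g 1)
  have h1 : g * 1 * g⁻¹ = 1 := by simp
  have hf : (fun h : G => h * g) ∘ (fun h : G => g * h * g⁻¹) = fun h => g * h := by
    funext h
    simp
  rw [hf, h1] at key
  exact key.symm

/-- Left translation by g is conjugation by g followed by right translation by g. As `chartRight` is
the identity at the unit, this determines `AdL` near 1 from two visibly smooth families. -/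
theorem chartRight_comp_AdL {x : E} (hx : x ∈ (extChartAt 𝓘(ℝ, E) (1 : G)).target) :
    (chartRight E G x).comp (AdL ((extChartAt 𝓘(ℝ, E) (1 : G)).symm x)) = chartLeft E G x := by
  rw [← mder_chart_mul_right hx, ← mder_chart_mul_left hx, ContinuousLinearMap.comp_assoc,
    mder_mul_right_comp_AdL]

theorem AdL_mul (g h : G) : (AdL (g * h) : E →L[ℝ] E) = (AdL g).comp (AdL h) :=
  ContinuousLinearMap.ext fun X => Ad_mul g h X

variable [CompleteSpace E]

/-- Near 1, `Ad` is the inverse of `chartRight` composed with `chartLeft`, and inversion is smooth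
at an invertible operator. -/
theorem contMDiffAt_AdL_one : ContMDiffAt 𝓘(ℝ, E) 𝓘(ℝ, E →L[ℝ] E) ∞ (AdL : G → E →L[ℝ] E) 1 := by
  have hR : (chartRight E G (chartOne E G)).IsInvertible := by
    rw [chartRight_one]
    exact ⟨ContinuousLinearEquiv.refl ℝ E, rfl⟩
  have hA : ContDiffAt ℝ ∞ (fun x => (chartRight E G x).inverse.comp (chartLeft E G x))
      (chartOne E G) :=
    (ContDiffAt.clm_comp (ContDiffAt.comp (g := ContinuousLinearMap.inverse) _
      (hR.contDiffAt_map_inverse) contDiffAt_chartRight) contDiffAt_chartLeft)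
  have hev : (AdL : G → E →L[ℝ] E) =ᶠ[𝓝 1]
      (fun x => (chartRight E G x).inverse.comp (chartLeft E G x)) ∘
        (extChartAt 𝓘(ℝ, E) (1 : G)) := by
    have hinv : ∀ᶠ x in 𝓝 (chartOne E G), (chartRight E G x).IsInvertible := by
      have := (contDiffAt_chartRight (E := E) (G := G)).continuousAt
      obtain ⟨e, he⟩ := hR
      have h2 := ContinuousLinearEquiv.nhds e
      rw [he] at h2
      exact this h2
    have ht : Tendsto (extChartAt 𝓘(ℝ, E) (1 : G)) (𝓝 1) (𝓝 (chartOne E G)) :=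
      continuousAt_extChartAt (1 : G)
    filter_upwards [ht.eventually hinv, extChartAt_source_mem_nhds (I := 𝓘(ℝ, E)) (1 : G)]
      with g hg hs
    have h1 := chartRight_comp_AdL ((extChartAt 𝓘(ℝ, E) (1 : G)).map_source hs)
    rw [(extChartAt 𝓘(ℝ, E) (1 : G)).left_inv hs] at h1
    simp only [Function.comp]
    rw [← h1, ← ContinuousLinearMap.comp_assoc, hg.inverse_comp_self, ContinuousLinearMap.id_comp]
  refine ContMDiffAt.congr_of_eventuallyEq ?_ hev
  exact ContMDiffAt.comp (1 : G) hA.contMDiffAt contMDiffAt_extChartAt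

theorem contMDiff_AdL : ContMDiff 𝓘(ℝ, E) 𝓘(ℝ, E →L[ℝ] E) ∞ (AdL : G → E →L[ℝ] E) := by
  intro g
  -- Multiplicativity transports smoothness from 1 to g.
  have h : (AdL : G → E →L[ℝ] E) = (fun A => (AdL g).comp A) ∘ AdL ∘ fun h => g⁻¹ * h := by
    funext h
    simp [← AdL_mul]
  rw [h]
  have h1 : ContMDiffAt 𝓘(ℝ, E) 𝓘(ℝ, E →L[ℝ] E) ∞ (AdL : G → E →L[ℝ] E) (g⁻¹ * g) := by
    rw [inv_mul_cancel]
    exact contMDiffAt_AdL_one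
  refine ContMDiffAt.comp g ?_ (ContMDiffAt.comp g h1 contMDiff_mul_left.contMDiffAt)
  exact (ContinuousLinearMap.contDiff (ContinuousLinearMap.compL ℝ E E E (AdL g))).contMDiff.contMDiffAt

variable (E G) in
/-- The adjoint representation of the Lie algebra, as the differential of `Ad`. -/
def adL : E →L[ℝ] E →L[ℝ] E :=
  mder (AdL : G → E →L[ℝ] E) 1

/-- Differentiate R(x) ∘ Ad(x) = L(x) at the unit, where R and Ad are the identity: DR(X)Y + ad(X)Y
= DL(X)Y. Symmetry of the mixed second derivatives turns DR(X)Y into DL(Y)X. -/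
theorem adL_apply (X Y : E) : adL E G X Y =
    fderiv ℝ (chartLeft E G) (chartOne E G) X Y - fderiv ℝ (chartLeft E G) (chartOne E G) Y X := by
  have hd : MDifferentiableAt 𝓘(ℝ, E) 𝓘(ℝ, E →L[ℝ] E) (AdL : G → E →L[ℝ] E) 1 :=
    contMDiffAt_AdL_one.mdifferentiableAt (by simp)
  have h1 : adL E G = fderiv ℝ (AdL ∘ (extChartAt 𝓘(ℝ, E) (1 : G)).symm) (chartOne E G) :=
    mder_eq_fderiv hd
  set A : E → E →L[ℝ] E := AdL ∘ (extChartAt 𝓘(ℝ, E) (1 : G)).symm with hA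
  have hdA : DifferentiableAt ℝ A (chartOne E G) := by
    rw [← mdifferentiableAt_iff_differentiableAt]
    refine MDifferentiableAt.comp (chartOne E G) (I' := 𝓘(ℝ, E)) ?_ ?_
    · rw [extChartAt_symm_chartOne]
      exact hd
    · exact (contMDiffOn_extChartAt_symm (I := 𝓘(ℝ, E)) (n := ∞) (1 : G)).contMDiffAt
        (extChartAt_target_mem_nhds (1 : G)) |>.mdifferentiableAt (by simp)
  have hev : (fun x => (chartRight E G x).comp (A x)) =ᶠ[𝓝 (chartOne E G)] chartLeft E G := by
    filter_upwards [extChartAt_target_mem_nhds (I := 𝓘(ℝ, E)) (1 : G)] with x hx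
    exact chartRight_comp_AdL hx
  have hR := ((contDiffAt_chartRight (E := E) (G := G)).differentiableAt (by simp)).hasFDerivAt
  have hder := (hR.clm_comp hdA.hasFDerivAt).fderiv
  erw [hev.fderiv_eq] at hder
  have hA1 : A (chartOne E G) = ContinuousLinearMap.id ℝ E := by
    simp only [hA, Function.comp]
    rw [extChartAt_symm_chartOne, AdL_one]
  have := congrArg (fun T : E →L[ℝ] E →L[ℝ] E => T X Y) hder
  simp [hA1, chartRight_one, fderiv_chartRight_apply] at this
  rw [this, h1]
  abel

/-- The left-invariant vector field with value `Z` at `1`, read in the chart at the identity. -/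
def chartField (E : Type*) [NormedAddCommGroup E] [NormedSpace ℝ E]
    (G : Type*) [TopologicalSpace G] [ChartedSpace E G] [Group G] (Z : LieAlg E G) : E → E :=
  mpullbackWithin 𝓘(ℝ, E) 𝓘(ℝ, E) (extChartAt 𝓘(ℝ, E) (1 : G)).symm
    (mulInvariantVectorField Z) (range 𝓘(ℝ, E))

-- Pulling back along the inverse chart applies the derivative of the chart, and a left-invariant
-- field is the derivative of left translation applied to its value at 1.
omit [CompleteSpace E] in
theorem chartField_eventuallyEq (Z : E) :
    chartField E G Z =ᶠ[𝓝 (chartOne E G)] fun x => chartLeft E G x Z := by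
  filter_upwards [extChartAt_target_mem_nhds (I := 𝓘(ℝ, E)) (1 : G)] with x hx
  have h1 := mfderiv_extChartAt_comp_mfderivWithin_extChartAt_symm (I := 𝓘(ℝ, E)) hx
  have h2 := mfderivWithin_extChartAt_symm_comp_mfderiv_extChartAt (I := 𝓘(ℝ, E)) hx
  refine (congrArg (fun T : E →L[ℝ] E => T (mulInvariantVectorField (I := 𝓘(ℝ, E)) Z
    ((extChartAt 𝓘(ℝ, E) (1 : G)).symm x))) (ContinuousLinearMap.inverse_eq h2 h1)).trans ?_
  rw [← mder_chart_mul_left hx]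
  rfl

theorem lieBracketWithin_chartField (V W : E) (s : Set E) (hs : s = univ) :
    lieBracketWithin ℝ (chartField E G V) (chartField E G W) s (chartOne E G) =
      adL E G V W := by
  have hL := (contDiffAt_chartLeft (E := E) (G := G)).differentiableAt (by simp)
  have hfd : ∀ V W : E, fderiv ℝ (fun x => chartLeft E G x V) (chartOne E G) W =
      fderiv ℝ (chartLeft E G) (chartOne E G) W V := by
    intro V W
    rw [fderiv_clm_apply hL (differentiableAt_const V)]
    simp
  have hV := chartField_eventuallyEq (E := E) (G := G) V
  have hW := chartField_eventuallyEq (E := E) (G := G) W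
  rw [hs, lieBracketWithin_univ, lieBracket, hV.fderiv_eq, hW.fderiv_eq, hV.eq_of_nhds,
    hW.eq_of_nhds, chartLeft_one, adL_apply, hfd, hfd]
  rfl

/-- The bracket of the Lie algebra of a Lie group is the differential of the adjoint action. -/
theorem bracket_eq_adL (X Y : LieAlg E G) : (⁅X, Y⁆ : LieAlg E G) = adL E G X Y := by
  have hid : (mder (extChartAt 𝓘(ℝ, E) (1 : G)) 1 : E →L[ℝ] E) = ContinuousLinearMap.id ℝ E := by
    rw [mder_eq_fderiv (mdifferentiableAt_extChartAt (mem_chart_source E (1 : G)))]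
    have : (extChartAt 𝓘(ℝ, E) (1 : G)) ∘ (extChartAt 𝓘(ℝ, E) (1 : G)).symm
      =ᶠ[𝓝 (chartOne E G)] id := eventually_chart_leftInverse
    exact this.fderiv_eq.trans fderiv_id
  -- The bracket of fields on a manifold is by definition the bracket in the chart, pulled back by
  -- the derivative of the chart; the set below is the whole model space.
  have h4 : (⁅X, Y⁆ : LieAlg E G) = (mder (extChartAt 𝓘(ℝ, E) (1 : G)) 1 : E →L[ℝ] E).inverse
    (lieBracketWithin ℝ (chartField E G X) (chartField E G Y)
      ((extChartAt 𝓘(ℝ, E) (1 : G)).symm ⁻¹' univ ∩ range 𝓘(ℝ, E)) (chartOne E G)) := rfl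
  refine h4.trans ((congrArg (mder (extChartAt 𝓘(ℝ, E) (1 : G)) 1 : E →L[ℝ] E).inverse
    (lieBracketWithin_chartField (E := E) (G := G) X Y _
      (by rw [preimage_univ, univ_inter]; exact ModelWithCorners.range_eq_univ _))).trans ?_)
  rw [hid, ContinuousLinearMap.inverse_id]
  rfl

end LieGroupBasics

/-! ### Chain and Leibniz rules for vector-valued maps -/

section VectorValued

variable {E : Type*} [NormedAddCommGroup E] [NormedSpace ℝ E]
  {G : Type*} [TopologicalSpace G] [ChartedSpace E G]
  {F F' F'' : Type*} [NormedAddCommGroup F] [NormedSpace ℝ F]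
  [NormedAddCommGroup F'] [NormedSpace ℝ F'] [NormedAddCommGroup F''] [NormedSpace ℝ F'']

theorem mder_clm_comp (T : F →L[ℝ] F') {f : G → F} {x : G}
    (hf : MDifferentiableAt 𝓘(ℝ, E) 𝓘(ℝ, F) f x) :
    (mder (fun y => T (f y)) x : E →L[ℝ] F') = T.comp (mder f x) := by
  have := mder_comp (g := T) x (T.mdifferentiableAt) hf
  rw [mder_vector, T.fderiv] at this
  exact this

theorem differentiableAt_comp_chart {f : G → F} {x : G}
    (hf : MDifferentiableAt 𝓘(ℝ, E) 𝓘(ℝ, F) f x) :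
    DifferentiableAt ℝ (f ∘ (extChartAt 𝓘(ℝ, E) x).symm) (extChartAt 𝓘(ℝ, E) x x) := by
  have := hf.differentiableWithinAt_writtenInExtChartAt
  rw [ModelWithCorners.range_eq_univ, differentiableWithinAt_univ] at this
  exact this

theorem mder_bilin (b : F →L[ℝ] F' →L[ℝ] F'') {f : G → F} {g : G → F'} {x : G}
    (hf : MDifferentiableAt 𝓘(ℝ, E) 𝓘(ℝ, F) f x) (hg : MDifferentiableAt 𝓘(ℝ, E) 𝓘(ℝ, F') g x)
    (X : E) :
    (mder (fun y => b (f y) (g y)) x : E →L[ℝ] F'') X =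
      b (f x) ((mder g x : E →L[ℝ] F') X) + b ((mder f x : E →L[ℝ] F) X) (g x) := by
  have hfg : MDifferentiableAt 𝓘(ℝ, E) 𝓘(ℝ, F'') (fun y => b (f y) (g y)) x := by
    have hb : DifferentiableAt ℝ (fun z : F × F' => b z.1 z.2) (f x, g x) :=
      b.isBoundedBilinearMap.differentiableAt _
    exact MDifferentiableAt.comp (g := fun z : F × F' => b z.1 z.2) x hb.mdifferentiableAt
      (hf.prodMk_space hg)
  have e : x = (extChartAt 𝓘(ℝ, E) x).symm (extChartAt 𝓘(ℝ, E) x x) :=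
    (extChartAt_to_inv (I := 𝓘(ℝ, E)) x).symm
  rw [mder_eq_fderiv hf, mder_eq_fderiv hg, mder_eq_fderiv hfg]
  have := b.fderiv_of_bilinear (differentiableAt_comp_chart hf) (differentiableAt_comp_chart hg)
  refine (congrArg (fun T : E →L[ℝ] F'' => T X) this).trans ?_
  simp only [Function.comp, ← e]
  simp [ContinuousLinearMap.precompR, ContinuousLinearMap.precompL]

end VectorValued

/-! ### Smooth homomorphisms and their differentials -/

section Hom

open Filter Topology

variable {E : Type*} [NormedAddCommGroup E] [NormedSpace ℝ E]
  {G : Type*} [TopologicalSpace G] [ChartedSpace E G] [Group G] [LieGroup 𝓘(ℝ, E) ∞ G]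
  {E' : Type*} [NormedAddCommGroup E'] [NormedSpace ℝ E']
  {K : Type*} [TopologicalSpace K] [ChartedSpace E' K] [Group K] [LieGroup 𝓘(ℝ, E') ∞ K]

/-- The differential at `1` of a smooth homomorphism intertwines the adjoint actions. -/
theorem mder_hom_AdL (φ : K →* G) (hφ : ContMDiff 𝓘(ℝ, E') 𝓘(ℝ, E) ∞ φ) (k : K) (X : E') :
    (mder φ 1 : E' →L[ℝ] E) (AdL k X) = AdL (φ k) ((mder φ 1 : E' →L[ℝ] E) X) := by
  have hd : MDifferentiable 𝓘(ℝ, E') 𝓘(ℝ, E) φ := hφ.mdifferentiable (by simp)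
  have h1 := mder_comp (1 : K) (hd (k * 1 * k⁻¹)) (conj_mdifferentiable (E := E') k 1)
  have h2 := mder_comp (1 : K) (conj_mdifferentiable (E := E) (φ k) (φ 1)) (hd 1)
  have e1 : k * 1 * k⁻¹ = 1 := by simp
  have hf : φ ∘ (fun h : K => k * h * k⁻¹) = (fun h => φ k * h * (φ k)⁻¹) ∘ φ := by
    funext h
    simp
  rw [e1, hf, h2, map_one] at h1
  exact (congrArg (fun T : E' →L[ℝ] E => T X) h1).symm

variable [CompleteSpace E]

theorem mdifferentiableAt_AdL_apply (Y : E) (g : G) :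
    MDifferentiableAt 𝓘(ℝ, E) 𝓘(ℝ, E) (fun g : G => AdL g Y) g := by
  have h : ContMDiff 𝓘(ℝ, E) 𝓘(ℝ, E) ∞ (fun g : G => (AdL g : E →L[ℝ] E) Y) :=
    contMDiff_AdL.clm_apply contMDiff_const
  exact h.mdifferentiableAt (by simp)

theorem mder_AdL_apply (X Y : E) :
    (mder (fun g : G => (AdL g : E →L[ℝ] E) Y) 1 : E →L[ℝ] E) X = adL E G X Y := by
  have := mder_clm_comp (ContinuousLinearMap.apply ℝ E Y) (f := (AdL : G → E →L[ℝ] E)) (x := 1)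
    (contMDiffAt_AdL_one.mdifferentiableAt (by simp))
  exact congrArg (fun T : E →L[ℝ] E => T X) this

theorem adL_skew (X Y : E) : adL E G X Y = -adL E G Y X := by
  rw [adL_apply, adL_apply]
  abel

variable [CompleteSpace E']

/-- The differential at `1` of a smooth homomorphism is a homomorphism of Lie algebras. -/
theorem mder_hom_adL (φ : K →* G) (hφ : ContMDiff 𝓘(ℝ, E') 𝓘(ℝ, E) ∞ φ) (X Y : E') :
    (mder φ 1 : E' →L[ℝ] E) (adL E' K X Y) =
      adL E G ((mder φ 1 : E' →L[ℝ] E) X) ((mder φ 1 : E' →L[ℝ] E) Y) := by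
  set T : E' →L[ℝ] E := mder φ 1 with hT
  have h : (fun k : K => T (AdL k Y)) = (fun g : G => (AdL g : E →L[ℝ] E) (T Y)) ∘ φ := by
    funext k
    exact mder_hom_AdL φ hφ k Y
  have h1 := mder_clm_comp T (mdifferentiableAt_AdL_apply (G := K) Y 1)
  rw [h, mder_comp (1 : K) (mdifferentiableAt_AdL_apply (T Y) (φ 1))
    (hφ.mdifferentiableAt (by simp)), map_one] at h1
  have := congrArg (fun S : E' →L[ℝ] E => S X) h1
  simp only [ContinuousLinearMap.comp_apply, mder_AdL_apply] at this
  exact this.symm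

end Hom

/-! ### The invariant inner product -/

section Inner

variable {E : Type*} [NormedAddCommGroup E] [NormedSpace ℝ E] [FiniteDimensional ℝ E]
  {G : Type*} [TopologicalSpace G] [ChartedSpace E G] [Group G]

/-- A bilinear form on the Lie algebra as a continuous bilinear form on the model space. -/
def innerL (B : LinearMap.BilinForm ℝ (LieAlg E G)) : E →L[ℝ] E →L[ℝ] ℝ :=
  LinearMap.toContinuousBilinearMap (show E →ₗ[ℝ] E →ₗ[ℝ] ℝ from B)

variable {B : LinearMap.BilinForm ℝ (LieAlg E G)} (hB : IsAdInvariantInner B)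
include hB

theorem innerL_symm (X Y : E) : innerL B X Y = innerL B Y X := hB.symm X Y

theorem innerL_pos (X : E) (hX : X ≠ 0) : 0 < innerL B X X := hB.pos X hX

theorem innerL_AdL (g : G) (X Y : E) : innerL B (AdL g X) (AdL g Y) = innerL B X Y :=
  hB.invariant g X Y

variable [LieGroup 𝓘(ℝ, E) ∞ G]

theorem innerL_AdL_left (g : G) (X Y : E) : innerL B (AdL g X) Y = innerL B X (AdL g⁻¹ Y) := by
  have h : AdL g (AdL g⁻¹ Y) = Y := by
    rw [← ContinuousLinearMap.comp_apply, ← AdL_mul, mul_inv_cancel, AdL_one]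
    rfl
  rw [← innerL_AdL hB g X, h]

/-- The derivative at 1 of the constant function g ↦ (Ad g Y, Ad g Z). -/
theorem innerL_adL (X Y Z : E) : innerL B (adL E G X Y) Z = -innerL B Y (adL E G X Z) := by
  have hY := mdifferentiableAt_AdL_apply (E := E) (G := G) Y 1
  have hZ := mdifferentiableAt_AdL_apply (E := E) (G := G) Z 1
  have h2 : (fun g : G => innerL B (AdL g Y) (AdL g Z)) = fun _ => innerL B Y Z := by
    funext g
    exact innerL_AdL hB g Y Z
  have h3 := mder_bilin (innerL B) hY hZ X
  rw [h2, mder_AdL_apply, mder_AdL_apply, AdL_one] at h3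
  have h4 : (mder (fun _ : G => innerL B Y Z) 1 : E →L[ℝ] ℝ) = 0 := mfderiv_const
  rw [h4] at h3
  simp only [zero_apply, ContinuousLinearMap.id_apply] at h3
  linarith

end Inner

/-! ### Injectivity of the differential of an immersion -/

section Immersion

open Filter Topology

/-- In adapted charts an immersion is u ↦ (u, 0), so reading `f` in the target chart and taking the
first component gives back the chart of the source, whose differential has a left inverse. -/
theorem mder_injective_of_isImmersionAt {E E' : Type*} [NormedAddCommGroup E] [NormedSpace ℝ E]
    [NormedAddCommGroup E'] [NormedSpace ℝ E']
    {M N : Type*} [TopologicalSpace M] [ChartedSpace E' M] [TopologicalSpace N] [ChartedSpace E N]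
    {f : M → N} {x : M} [IsManifold 𝓘(ℝ, E') ∞ M] [IsManifold 𝓘(ℝ, E) ∞ N]
    (h : Manifold.IsImmersionAt 𝓘(ℝ, E') 𝓘(ℝ, E) ∞ f x) :
    Function.Injective (mder f x : E' →L[ℝ] E) := by
  have hφ : MDifferentiableAt 𝓘(ℝ, E') 𝓘(ℝ, E') h.domChart x :=
    ((contMDiffOn_of_mem_maximalAtlas h.domChart_mem_maximalAtlas).contMDiffAt
      (h.domChart.open_source.mem_nhds h.mem_domChart_source)).mdifferentiableAt (by simp)
  have hφs : MDifferentiableAt 𝓘(ℝ, E') 𝓘(ℝ, E') h.domChart.symm (h.domChart x) :=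
    ((contMDiffOn_symm_of_mem_maximalAtlas h.domChart_mem_maximalAtlas).contMDiffAt
      (h.domChart.open_target.mem_nhds
        (h.domChart.map_source h.mem_domChart_source))).mdifferentiableAt (by simp)
  have hψ : MDifferentiableAt 𝓘(ℝ, E) 𝓘(ℝ, E) h.codChart (f x) :=
    ((contMDiffOn_of_mem_maximalAtlas h.codChart_mem_maximalAtlas).contMDiffAt
      (h.codChart.open_source.mem_nhds h.mem_codChart_source)).mdifferentiableAt (by simp)
  have hf : MDifferentiableAt 𝓘(ℝ, E') 𝓘(ℝ, E) f x := h.contMDiffAt.mdifferentiableAt (by simp)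
  have e1 : (fun y => ((ContinuousLinearMap.fst ℝ E' h.complement).comp
      (h.equiv.symm : E →L[ℝ] E' × h.complement)) ((h.codChart ∘ f) y)) =ᶠ[𝓝 x] h.domChart := by
    filter_upwards [h.domChart.open_source.mem_nhds h.mem_domChart_source] with y hy
    have ht : h.domChart y ∈ (h.domChart.extend 𝓘(ℝ, E')).target := by
      simpa using h.domChart.map_source hy
    have := h.writtenInCharts ht
    simp [h.domChart.left_inv hy] at this
    simp [this]
  have e2 : h.domChart.symm ∘ h.domChart =ᶠ[𝓝 x] id := by
    filter_upwards [h.domChart.open_source.mem_nhds h.mem_domChart_source] with y hy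
    exact h.domChart.left_inv hy
  have d1 := mder_congr (E := E') (F := E') e1
  have d2 := mder_congr (E := E') (F := E') e2
  rw [mder_comp x hφs hφ, mder_id] at d2
  rw [mder_clm_comp _ (hψ.comp x hf), mder_comp x hψ hf] at d1
  intro v w hvw
  have d3 : (mder h.domChart x : E' →L[ℝ] E') v = (mder h.domChart x : E' →L[ℝ] E') w := by
    rw [← d1]
    simp [hvw]
  have hv := congrArg (fun T : E' →L[ℝ] E' => T v) d2
  have hw := congrArg (fun T : E' →L[ℝ] E' => T w) d2
  simp only [ContinuousLinearMap.comp_apply, ContinuousLinearMap.id_apply] at hv hw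
  rw [← hv, ← hw, d3]

end Immersion

/-! ### Riesz representation for a pulled-back inner product -/

section Sharp

variable {E E' : Type*} [NormedAddCommGroup E] [NormedSpace ℝ E]
  [NormedAddCommGroup E'] [NormedSpace ℝ E'] [FiniteDimensional ℝ E']

theorem eq_of_forall_inner_eq {b : E →L[ℝ] E →L[ℝ] ℝ} (hb : ∀ X, X ≠ 0 → 0 < b X X)
    {j : E' →L[ℝ] E} (hj : Function.Injective j) {v v' : E'}
    (h : ∀ w, b (j v) (j w) = b (j v') (j w)) : v = v' := by
  by_contra hne
  have h1 : j (v - v') ≠ 0 := fun h0 => hne (sub_eq_zero.mp (hj (by simpa using h0)))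
  have h2 := hb _ h1
  have h3 := h (v - v')
  rw [map_sub, map_sub] at h2
  simp only [map_sub, sub_apply] at h2 h3
  linarith

/-- The map from `E'` to its dual is injective by definiteness, hence bijective by equality of
dimensions. -/
theorem exists_sharp {b : E →L[ℝ] E →L[ℝ] ℝ} (hb : ∀ X, X ≠ 0 → 0 < b X X)
    {j : E' →L[ℝ] E} (hj : Function.Injective j) :
    ∃ S : (E' →L[ℝ] ℝ) →L[ℝ] E', ∀ l w, b (j (S l)) (j w) = l w := by
  let T : E' →ₗ[ℝ] (E' →L[ℝ] ℝ) :=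
    ((ContinuousLinearMap.precomp ℝ j).comp (b.comp j)).toLinearMap
  have hT : ∀ v w, T v w = b (j v) (j w) := fun v w => rfl
  have hinj : Function.Injective T := fun v v' h =>
    eq_of_forall_inner_eq hb hj fun w => by rw [← hT, ← hT, h]
  have hdim : Module.finrank ℝ E' = Module.finrank ℝ (E' →L[ℝ] ℝ) := by
    rw [← (LinearMap.toContinuousLinearMap (𝕜 := ℝ) (E := E') (F' := ℝ)).finrank_eq]
    exact (Subspace.dual_finrank_eq).symm
  let e := LinearEquiv.ofInjectiveOfFinrankEq T hinj hdim
  refine ⟨LinearMap.toContinuousLinearMap e.symm.toLinearMap, fun l w => ?_⟩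
  rw [← hT]
  have : T (e.symm l) = l := e.apply_symm_apply l
  exact congrArg (fun m : E' →L[ℝ] ℝ => m w) this

end Sharp

/-! ### Lie subalgebras, orthogonal projections and gradients -/

section Subgroup

open Filter Topology

variable {E : Type*} [NormedAddCommGroup E] [NormedSpace ℝ E] [FiniteDimensional ℝ E]
  {G : Type*} [TopologicalSpace G] [ChartedSpace E G] [Group G] [LieGroup 𝓘(ℝ, E) ∞ G]
  {E' : Type*} [NormedAddCommGroup E'] [NormedSpace ℝ E'] [FiniteDimensional ℝ E']
  {K : Subgroup G} [ChartedSpace E' K] [LieGroup 𝓘(ℝ, E') ∞ K]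
  {E'' : Type*} [NormedAddCommGroup E''] [NormedSpace ℝ E''] [FiniteDimensional ℝ E'']
  {K' : Subgroup G} [ChartedSpace E'' K'] [LieGroup 𝓘(ℝ, E'') ∞ K']

/-- The differential of the inclusion of a subgroup, between the model spaces. -/
def inclL (E : Type*) [NormedAddCommGroup E] [NormedSpace ℝ E]
    {G : Type*} [TopologicalSpace G] [ChartedSpace E G] [Group G]
    (E' : Type*) [NormedAddCommGroup E'] [NormedSpace ℝ E'] (K : Subgroup G) [ChartedSpace E' K] :
    E' →L[ℝ] E := mder (Subtype.val : K → G) 1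

section

variable (hK : Manifold.IsSmoothEmbedding 𝓘(ℝ, E') 𝓘(ℝ, E) ∞ (Subtype.val : K → G))
include hK

theorem inclL_injective : Function.Injective (inclL E E' K) := by
  have : IsManifold 𝓘(ℝ, E') ∞ K := ContMDiffMul.toIsManifold (I := 𝓘(ℝ, E')) (n := ∞)
  have : IsManifold 𝓘(ℝ, E) ∞ G := ContMDiffMul.toIsManifold (I := 𝓘(ℝ, E)) (n := ∞)
  exact mder_injective_of_isImmersionAt (hK.isImmersion.isImmersionAt 1)

theorem inclL_AdL (k : K) (X : E') : inclL E E' K (AdL k X) = AdL (k : G) (inclL E E' K X) :=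
  mder_hom_AdL K.subtype hK.contMDiff k X

theorem inclL_adL (X Y : E') :
    inclL E E' K (adL E' K X Y) = adL E G (inclL E E' K X) (inclL E E' K Y) :=
  mder_hom_adL K.subtype hK.contMDiff X Y

/-- The inclusion K' → K is continuous and its composite with the immersion K → G is smooth, so it
is itself smooth; σ is its differential. -/
theorem exists_inclL_comp
    (hK' : Manifold.IsSmoothEmbedding 𝓘(ℝ, E'') 𝓘(ℝ, E) ∞ (Subtype.val : K' → G)) (h : K' ≤ K) :
    ∃ σ : E'' →L[ℝ] E', ∀ v, inclL E E' K (σ v) = inclL E E'' K' v := by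
  have h1 : ContMDiffAt 𝓘(ℝ, E'') 𝓘(ℝ, E') ∞ (Subgroup.inclusion h) 1 := by
    rw [ContMDiffAt.iff_comp_isImmersionAt (hK.isImmersion.isImmersionAt _)]
    exact ⟨(continuous_inclusion h).continuousAt, hK'.contMDiff.contMDiffAt⟩
  refine ⟨mder (Subgroup.inclusion h) 1, fun v => ?_⟩
  have := mder_comp (g := (Subtype.val : K → G)) 1 (hK.contMDiff.mdifferentiableAt (by simp))
    (h1.mdifferentiableAt (by simp))
  exact (congrArg (fun T : E'' →L[ℝ] E => T v) this).symm

end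

variable (B : LinearMap.BilinForm ℝ (LieAlg E G))

variable (E' K) in
/-- The isomorphism from the dual of the Lie algebra of `K` given by the restricted inner
product. -/
def sharpL : (E' →L[ℝ] ℝ) →L[ℝ] E' :=
  Classical.epsilon fun S => ∀ l w, innerL B (inclL E E' K (S l)) (inclL E E' K w) = l w

variable (E' K) in
/-- The orthogonal projection, between the model spaces. -/
def projL : E →L[ℝ] E' :=
  (sharpL E' K B).comp
    ((ContinuousLinearMap.compL ℝ E' E ℝ).flip (inclL E E' K) ∘L (innerL B))

variable {B} (hB : IsAdInvariantInner B)
  (hK : Manifold.IsSmoothEmbedding 𝓘(ℝ, E') 𝓘(ℝ, E) ∞ (Subtype.val : K → G))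
include hB hK

theorem innerL_sharpL (l : E' →L[ℝ] ℝ) (w : E') :
    innerL B (inclL E E' K (sharpL E' K B l)) (inclL E E' K w) = l w :=
  Classical.epsilon_spec (exists_sharp (innerL_pos hB) (inclL_injective hK)) l w

theorem eq_sharpL {l : E' →L[ℝ] ℝ} {v : E'}
    (h : ∀ w, innerL B (inclL E E' K v) (inclL E E' K w) = l w) : v = sharpL E' K B l :=
  eq_of_forall_inner_eq (innerL_pos hB) (inclL_injective hK) fun w => by
    rw [h, innerL_sharpL hB hK]

theorem epsilon_eq_sharpL (l : E' →L[ℝ] ℝ) :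
    (Classical.epsilon fun v : E' =>
      ∀ w : E', innerL B (inclL E E' K v) (inclL E E' K w) = l w) = sharpL E' K B l :=
  eq_sharpL hB hK (Classical.epsilon_spec (p := fun v : E' =>
      ∀ w : E', innerL B (inclL E E' K v) (inclL E E' K w) = l w)
    ⟨sharpL E' K B l, innerL_sharpL hB hK l⟩)

theorem innerL_projL (Z : E) (w : E') :
    innerL B (inclL E E' K (projL E' K B Z)) (inclL E E' K w) = innerL B Z (inclL E E' K w) :=
  innerL_sharpL hB hK _ w

theorem eq_projL {Z : E} {v : E'}
    (h : ∀ w, innerL B (inclL E E' K v) (inclL E E' K w) = innerL B Z (inclL E E' K w)) :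
    v = projL E' K B Z :=
  eq_sharpL hB hK h

theorem proj_eq_projL (Z : E) : proj B K Z = projL E' K B Z :=
  epsilon_eq_sharpL hB hK ((innerL B Z).comp (inclL E E' K))

theorem grad_eq_sharpL (F : E' → ℝ) (Y : E') : grad B K F Y = sharpL E' K B (fderiv ℝ F Y) :=
  epsilon_eq_sharpL hB hK _

/-- Equivariance of the moment map. -/
theorem projL_AdL (k : K) (Z : E) :
    projL E' K B (AdL (k : G) Z) = AdL k (projL E' K B Z) := by
  refine (eq_projL hB hK fun w => ?_).symm
  rw [inclL_AdL hK, innerL_AdL_left hB, innerL_AdL_left hB, ← Subgroup.coe_inv, ← inclL_AdL hK,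
    innerL_projL hB hK]

/-- Infinitesimal equivariance, the source of the Lax equation: `ad` of an element of 𝔨 is skew and
preserves 𝔨, so it commutes with the orthogonal projection to 𝔨. -/
theorem projL_adL (X : E') (Z : E) :
    projL E' K B (adL E G (inclL E E' K X) Z) = adL E' K X (projL E' K B Z) := by
  refine (eq_projL hB hK fun w => ?_).symm
  rw [inclL_adL hK, innerL_adL hB, innerL_adL hB, ← inclL_adL hK, innerL_projL hB hK]

theorem projL_inclL_projL
    (hK' : Manifold.IsSmoothEmbedding 𝓘(ℝ, E'') 𝓘(ℝ, E) ∞ (Subtype.val : K' → G)) (h : K' ≤ K)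
    (Z : E) : projL E'' K' B (inclL E E' K (projL E' K B Z)) = projL E'' K' B Z := by
  obtain ⟨σ, hσ⟩ := exists_inclL_comp hK hK' h
  refine eq_projL hB hK' fun w => ?_
  rw [innerL_projL hB hK', ← hσ, innerL_projL hB hK]

end Subgroup

/-! ### Hamiltonian vectors and Poisson brackets on the orbit -/

section Orbit

open Filter Topology

variable {E : Type*} [NormedAddCommGroup E] [NormedSpace ℝ E] [FiniteDimensional ℝ E]
  {G : Type*} [TopologicalSpace G] [ChartedSpace E G] [Group G] [LieGroup 𝓘(ℝ, E) ∞ G]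
  {Λ : LieAlg E G}

/-- A point of the orbit as a vector of the model space. -/
def ptL (Z : adjointOrbit Λ) : E := Z.1

theorem continuous_ptL : Continuous (ptL : adjointOrbit Λ → E) := continuous_subtype_val

theorem ptL_orbitAct (g : G) (Z : adjointOrbit Λ) : ptL (orbitAct g Z) = (AdL g : E →L[ℝ] E) (ptL Z) := rfl

theorem contMDiff_ptL_orbitMap :
    ContMDiff 𝓘(ℝ, E) 𝓘(ℝ, E) ∞ (fun g : G => ptL (orbitMap Λ g)) :=
  (contMDiff_AdL (E := E) (G := G)).clm_apply contMDiff_const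

theorem continuous_orbitMap : Continuous (orbitMap Λ : G → adjointOrbit Λ) :=
  continuous_induced_rng.mpr (contMDiff_ptL_orbitMap (Λ := Λ)).continuous

theorem orbitAct_one (Z : adjointOrbit Λ) : orbitAct (1 : G) Z = Z := by
  apply Subtype.ext
  change ptL (orbitAct (1 : G) Z) = ptL Z
  rw [ptL_orbitAct, AdL_one]
  rfl

theorem tendsto_orbitAct (Z : adjointOrbit Λ) :
    Tendsto (fun g : G => orbitAct g Z) (𝓝 1) (𝓝 Z) := by
  have h1 : Continuous (fun g : G => (AdL g : E →L[ℝ] E) (ptL Z)) :=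
    ((contMDiff_AdL (E := E) (G := G)).clm_apply (contMDiff_const (c := ptL Z))).continuous
  have h : Continuous (fun g : G => orbitAct g Z) := h1.subtype_mk _
  exact h.tendsto' _ _ (orbitAct_one Z)

/-- A function which is locally the restriction to the orbit of a smooth function on the Lie
algebra is smooth. -/
theorem smoothOnOrbit_of_local {W : Type*} [NormedAddCommGroup W] [NormedSpace ℝ W]
    {f : adjointOrbit Λ → W} {U : Set (adjointOrbit Λ)}
    (h : ∀ Z ∈ U, ∃ F : E → W, ContDiffAt ℝ ∞ F (ptL Z) ∧ f =ᶠ[𝓝 Z] fun Z' => F (ptL Z')) :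
    SmoothOnOrbit f U := by
  intro g hg
  obtain ⟨F, hF, hfF⟩ := h _ hg
  refine ContMDiffAt.contMDiffWithinAt ?_
  have h1 : ContMDiffAt 𝓘(ℝ, E) 𝓘(ℝ, W) ∞ (fun g : G => F (ptL (orbitMap Λ g))) g :=
    ContMDiffAt.comp (g := F) g hF.contMDiffAt contMDiff_ptL_orbitMap.contMDiffAt
  exact h1.congr_of_eventuallyEq ((continuous_orbitMap (Λ := Λ)).continuousAt.eventually hfF)

/-- The map `lift`, between the model spaces. -/
def liftL (Z : adjointOrbit Λ) (v : E) : E := lift Z v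

/-- A lift is determined only up to the centralizer of Z; this is all that can be used about it. -/
theorem adL_lift (Z : adjointOrbit Λ) (X : E) :
    adL E G (liftL Z (adL E G X (ptL Z))) (ptL Z) = adL E G X (ptL Z) := by
  have h := Classical.epsilon_spec (p := fun Y : LieAlg E G => ⁅Y, Z.1⁆ = adL E G X (ptL Z))
    ⟨X, bracket_eq_adL _ _⟩
  rw [bracket_eq_adL] at h
  exact h

/-- `f` is near `Z` the restriction to the orbit of a function on the Lie algebra whose
differential at `Z` is `D`. -/
def HasLocalDiff (f : adjointOrbit Λ → ℝ) (Z : adjointOrbit Λ) (D : E →L[ℝ] ℝ) : Prop :=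
  ∃ F : E → ℝ, HasFDerivAt F D (ptL Z) ∧ f =ᶠ[𝓝 Z] fun Z' => F (ptL Z')

theorem HasLocalDiff.mder_orbitAct {f : adjointOrbit Λ → ℝ} {Z : adjointOrbit Λ} {D : E →L[ℝ] ℝ}
    (h : HasLocalDiff f Z D) (X : E) :
    (mder (fun g : G => f (orbitAct g Z)) 1 : E →L[ℝ] ℝ) X = D (adL E G X (ptL Z)) := by
  obtain ⟨F, hF, hfF⟩ := h
  have h1 : (fun g : G => f (orbitAct g Z)) =ᶠ[𝓝 1] F ∘ fun g => (AdL g : E →L[ℝ] E) (ptL Z) :=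
    (tendsto_orbitAct Z).eventually hfF
  have e : (AdL (1 : G) : E →L[ℝ] E) (ptL Z) = ptL Z := by
    rw [AdL_one]
    rfl
  rw [mder_congr h1, mder_comp (F := E) (F' := ℝ), mder_vector, e, hF.fderiv]
  · exact congrArg D (mder_AdL_apply X (ptL Z))
  · rw [e]
    exact hF.differentiableAt.mdifferentiableAt
  · exact mdifferentiableAt_AdL_apply _ _

theorem HasLocalDiff.orbitDiff {f : adjointOrbit Λ → ℝ} {Z : adjointOrbit Λ} {D : E →L[ℝ] ℝ}
    (h : HasLocalDiff f Z D) (X : E) : orbitDiff f Z (adL E G X (ptL Z)) =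
      D (adL E G X (ptL Z)) := by
  exact (h.mder_orbitAct _).trans (congrArg D (adL_lift Z X))

variable {B : LinearMap.BilinForm ℝ (LieAlg E G)} (hB : IsAdInvariantInner B)
include hB

theorem innerL_adL_swap (Z U V : E) :
    innerL B (adL E G U Z) V = -innerL B (adL E G V Z) U := by
  rw [innerL_adL hB U, innerL_adL hB V, adL_skew U V, map_neg]

/-- Independence of the lifts: by invariance the form is ([U,Z],V), where U enters only through
[U,Z]. Antisymmetry then brings the other lift into the same position. -/
theorem kksForm_adL (Z : adjointOrbit Λ) (X Y : E) :
    kksForm B Z (adL E G X (ptL Z)) (adL E G Y (ptL Z)) = innerL B (adL E G X (ptL Z)) Y := by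
  have hX := adL_lift Z X
  have hY := adL_lift Z Y
  have h0 : ∀ U V : E, -innerL B (ptL Z) (adL E G U V) = innerL B (adL E G U (ptL Z)) V := by
    intro U V
    rw [innerL_adL hB]
  have hbr : ∀ U V : LieAlg E G, B Z.1 ⁅U, V⁆ = innerL B (ptL Z) (adL E G U V) :=
    fun U V => congrArg (fun v : E => innerL B (ptL Z) v) (bracket_eq_adL U V)
  have h1 : kksForm B Z (adL E G X (ptL Z)) (adL E G Y (ptL Z)) =
      -innerL B (ptL Z) (adL E G (liftL Z (adL E G X (ptL Z))) (liftL Z (adL E G Y (ptL Z)))) :=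
    congrArg Neg.neg (hbr _ _)
  rw [h1, h0, hX, innerL_adL_swap hB, hY, ← innerL_adL_swap hB]

theorem isHamiltonianVector_iff (f : adjointOrbit Λ → ℝ) (Z : adjointOrbit Λ) (v : E) :
    IsHamiltonianVector B f Z v ↔ (∃ X : E, adL E G X (ptL Z) = v) ∧
      ∀ Y : E, orbitDiff f Z (adL E G Y (ptL Z)) + kksForm B Z v (adL E G Y (ptL Z)) = 0 := by
  have hbr : ∀ Y : LieAlg E G, (⁅Y, Z.1⁆ : LieAlg E G) = adL E G Y (ptL Z) :=
    fun Y => bracket_eq_adL _ _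
  unfold IsHamiltonianVector
  simp only [hbr]
  exact Iff.rfl

/-- With `a` the gradient, df + ω([X,Z],·) evaluated on [Y,Z] is ([X,Z] - [a,Z], Y), so X = a is a
solution and definiteness leaves no other vector. -/
theorem hamiltonianVectorField_eq {f : adjointOrbit Λ → ℝ} {Z : adjointOrbit Λ} {D : E →L[ℝ] ℝ}
    (h : HasLocalDiff f Z D) {a : E} (ha : ∀ w, innerL B a w = D w) :
    hamiltonianVectorField B f Z = adL E G a (ptL Z) := by
  have key : ∀ X Y : E, orbitDiff f Z (adL E G Y (ptL Z)) +
      kksForm B Z (adL E G X (ptL Z)) (adL E G Y (ptL Z)) =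
        innerL B (adL E G X (ptL Z) - adL E G a (ptL Z)) Y := by
    intro X Y
    have h1 := innerL_adL hB (ptL Z) a Y
    rw [adL_skew (ptL Z) Y, map_neg, neg_neg] at h1
    rw [h.orbitDiff, kksForm_adL hB, ← ha, ← h1, adL_skew (ptL Z) a, map_sub,
      map_neg, sub_apply, neg_apply]
    ring
  have hex : IsHamiltonianVector B f Z (adL E G a (ptL Z)) := by
    rw [isHamiltonianVector_iff hB]
    refine ⟨⟨a, rfl⟩, fun Y => ?_⟩
    rw [key, sub_self, map_zero, zero_apply]
  have hspec : IsHamiltonianVector B f Z (hamiltonianVectorField B f Z) :=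
    Classical.epsilon_spec ⟨_, hex⟩
  obtain ⟨⟨X, hX⟩, hv⟩ := (isHamiltonianVector_iff hB f Z _).mp hspec
  refine hX.symm.trans ?_
  rw [← hX] at hv
  by_contra hne
  -- Test the equation with Y = [X,Z] - [a,Z].
  have hpos := innerL_pos hB _ (sub_ne_zero.mpr hne)
  rw [← key, hv] at hpos
  exact lt_irrefl _ hpos

theorem poissonBracket_eq {f h : adjointOrbit Λ → ℝ} {Z : adjointOrbit Λ} {D D' : E →L[ℝ] ℝ}
    (hf : HasLocalDiff f Z D) (hh : HasLocalDiff h Z D') {a : E} (ha : ∀ w, innerL B a w = D w)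
    {b : E} (hb : ∀ w, innerL B b w = D' w) :
    poissonBracket B f h Z = D' (adL E G a (ptL Z)) := by
  rw [poissonBracket, hamiltonianVectorField_eq hB hf ha, hamiltonianVectorField_eq hB hh hb,
    kksForm_adL hB, innerL_symm hB, hb]

theorem poissonBracket_skew {f h : adjointOrbit Λ → ℝ} {Z : adjointOrbit Λ} {D D' : E →L[ℝ] ℝ}
    (hf : HasLocalDiff f Z D) (hh : HasLocalDiff h Z D') {a : E} (ha : ∀ w, innerL B a w = D w)
    {b : E} (hb : ∀ w, innerL B b w = D' w) :
    poissonBracket B f h Z = -poissonBracket B h f Z := by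
  rw [poissonBracket_eq hB hf hh ha hb, poissonBracket_eq hB hh hf hb ha, ← ha, ← hb,
    innerL_symm hB b, innerL_symm hB a, innerL_adL_swap hB]

end Orbit

/-! ### Moment maps, commuting functions and the Lax equation -/

section Moment

open Filter Topology

variable {E : Type*} [NormedAddCommGroup E] [NormedSpace ℝ E] [FiniteDimensional ℝ E]
  {G : Type*} [TopologicalSpace G] [ChartedSpace E G] [Group G] [LieGroup 𝓘(ℝ, E) ∞ G]
  {Λ : LieAlg E G}
  {E' : Type*} [NormedAddCommGroup E'] [NormedSpace ℝ E'] [FiniteDimensional ℝ E']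
  {K : Subgroup G} [ChartedSpace E' K] [LieGroup 𝓘(ℝ, E') ∞ K]
  {E'' : Type*} [NormedAddCommGroup E''] [NormedSpace ℝ E''] [FiniteDimensional ℝ E'']
  {K' : Subgroup G} [ChartedSpace E'' K'] [LieGroup 𝓘(ℝ, E'') ∞ K']
  {B : LinearMap.BilinForm ℝ (LieAlg E G)} (hB : IsAdInvariantInner B)
  (hK : Manifold.IsSmoothEmbedding 𝓘(ℝ, E') 𝓘(ℝ, E) ∞ (Subtype.val : K → G))
include hB hK

/-- It identifies the ambient gradient of a function of the moment map: it lies in 𝔨. -/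
theorem innerL_inclL_sharpL (l : E' →L[ℝ] ℝ) (w : E) :
    innerL B (inclL E E' K (sharpL E' K B l)) w = l (projL E' K B w) := by
  rw [innerL_symm hB, ← innerL_projL hB hK, innerL_symm hB, innerL_sharpL hB hK]

theorem momentMap_eq (Z : adjointOrbit Λ) : momentMap B K Z = projL E' K B (ptL Z) :=
  proj_eq_projL hB hK (ptL Z)

theorem smoothOnOrbit_momentMap :
    SmoothOnOrbit (W := E') (fun Z : adjointOrbit Λ => (momentMap B K Z : LieAlg E' K))
      Set.univ :=
  smoothOnOrbit_of_local fun _ _ => ⟨projL E' K B, (projL E' K B).contDiff.contDiffAt,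
    Eventually.of_forall fun Z' => momentMap_eq hB hK Z'⟩

/-- A function which is locally a function of the moment map. -/
theorem hasLocalDiff_of_momentMap {f : adjointOrbit Λ → ℝ} {Z : adjointOrbit Λ} {F : E' → ℝ}
    (hF : DifferentiableAt ℝ F (projL E' K B (ptL Z)))
    (hf : f =ᶠ[𝓝 Z] fun Z' => F (projL E' K B (ptL Z'))) :
    HasLocalDiff f Z ((fderiv ℝ F (projL E' K B (ptL Z))).comp (projL E' K B)) :=
  ⟨F ∘ projL E' K B, hF.hasFDerivAt.comp _ (projL E' K B).hasFDerivAt, hf⟩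

/-- A function of the moment map of `K'` Poisson commutes with the functions invariant under a
larger group `K`. -/
theorem poissonBracket_eq_zero
    (hK' : Manifold.IsSmoothEmbedding 𝓘(ℝ, E'') 𝓘(ℝ, E) ∞ (Subtype.val : K' → G)) (hle : K' ≤ K)
    {f h : adjointOrbit Λ → ℝ} {Z : adjointOrbit Λ} {F : E'' → ℝ}
    (hF : DifferentiableAt ℝ F (projL E'' K' B (ptL Z)))
    (hf : f =ᶠ[𝓝 Z] fun Z' => F (projL E'' K' B (ptL Z')))
    {F' : E' → ℝ} (hF' : DifferentiableAt ℝ F' (projL E' K B (ptL Z)))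
    (hh : h =ᶠ[𝓝 Z] fun Z' => F' (projL E' K B (ptL Z')))
    (hinv : ∀ (k : K) (Z' : adjointOrbit Λ), h (orbitAct (k : G) Z') = h Z') :
    poissonBracket B f h Z = 0 := by
  have h1 := hasLocalDiff_of_momentMap hB hK' hF hf
  have h2 := hasLocalDiff_of_momentMap hB hK hF' hh
  rw [poissonBracket_eq hB h1 h2 (innerL_inclL_sharpL hB hK' _) (innerL_inclL_sharpL hB hK _)]
  -- The bracket is dh([a,Z]) with `a` in 𝔨' ⊆ 𝔨, that is, the derivative of k ↦ h(Ad k Z) along K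
  -- at 1, and this function is constant.
  obtain ⟨σ, hσ⟩ := exists_inclL_comp hK hK' hle
  rw [← hσ, ← h2.mder_orbitAct]
  set ξ := σ (sharpL E'' K' B (fderiv ℝ F ((projL E'' K' B) (ptL Z))))
  have hd : MDifferentiableAt 𝓘(ℝ, E) 𝓘(ℝ, ℝ) (fun g : G => h (orbitAct g Z)) 1 := by
    have e1 : (fun g : G => h (orbitAct g Z)) =ᶠ[𝓝 1]
        (F' ∘ projL E' K B) ∘ fun g => (AdL g : E →L[ℝ] E) (ptL Z) :=
      (tendsto_orbitAct Z).eventually hh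
    refine MDifferentiableAt.congr_of_eventuallyEq ?_ e1
    refine MDifferentiableAt.comp (I' := 𝓘(ℝ, E)) (1 : G) ?_ (mdifferentiableAt_AdL_apply _ _)
    have e : (AdL (1 : G) : E →L[ℝ] E) (ptL Z) = ptL Z := by
      rw [AdL_one]
      rfl
    rw [e]
    exact (hF'.comp _ (projL E' K B).differentiableAt).mdifferentiableAt
  have h3 := mder_comp (E := E') (F := E) (F' := ℝ) (g := fun g : G => h (orbitAct g Z))
    (f := (Subtype.val : K → G)) 1 hd (hK.contMDiff.mdifferentiableAt (by simp))
  have h4 : (fun g : G => h (orbitAct g Z)) ∘ (Subtype.val : K → G) = fun _ => h Z := by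
    funext k
    exact hinv k Z
  rw [h4] at h3
  have h5 : (mder (fun _ : K => h Z) 1 : E' →L[ℝ] ℝ) = 0 := mfderiv_const
  rw [h5] at h3
  exact (congrArg (fun T : E' →L[ℝ] ℝ => T ξ) h3).symm

variable
  (hK' : Manifold.IsSmoothEmbedding 𝓘(ℝ, E'') 𝓘(ℝ, E) ∞ (Subtype.val : K' → G)) (hle : K' ≤ K)
  {F : E'' → ℝ} (hF : ContDiff ℝ ∞ F)
include hK' hle hF

/-- Since π_{K'} ∘ π_K = π_{K'}, composing F with the relative projection does not change the
gradient, which remains in 𝔨'. Hence P is the vector generating the Hamiltonian motion. -/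
theorem exists_grad_eq : ∃ σ : E'' →L[ℝ] E', (∀ v, inclL E E' K (σ v) = inclL E E'' K' v) ∧
    ∀ Z : adjointOrbit Λ,
      grad B K (fun Y => F (relProj B K K' Y)) (momentMap B K Z : LieAlg E' K) =
        σ (sharpL E'' K' B (fderiv ℝ F (projL E'' K' B (ptL Z)))) := by
  obtain ⟨σ, hσ⟩ := exists_inclL_comp hK hK' hle
  refine ⟨σ, hσ, fun Z => ?_⟩
  have h1 : (fun Y : E' => F (relProj B K K' (Y : LieAlg E' K))) =
      F ∘ ((projL E'' K' B).comp (inclL E E' K)) := by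
    funext Y
    exact congrArg F (proj_eq_projL hB hK' (inclL E E' K Y))
  have h2 : grad B K (fun Y => F (relProj B K K' Y)) (momentMap B K Z : LieAlg E' K) =
      sharpL E' K B (fderiv ℝ (F ∘ ((projL E'' K' B).comp (inclL E E' K)))
        (projL E' K B (ptL Z))) := by
    rw [← h1, ← grad_eq_sharpL hB hK]
    exact congrArg (grad B K (fun Y => F (relProj B K K' Y))) (momentMap_eq hB hK Z)
  refine h2.trans (eq_sharpL hB hK fun w => ?_).symm
  have hFd : DifferentiableAt ℝ F ((projL E'' K' B) (inclL E E' K (projL E' K B (ptL Z)))) :=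
    (hF.differentiable (by simp)).differentiableAt
  have h3 := (HasFDerivAt.comp (projL E' K B (ptL Z)) (g := F)
    (f := (projL E'' K' B).comp (inclL E E' K)) hFd.hasFDerivAt
    ((projL E'' K' B).comp (inclL E E' K)).hasFDerivAt).fderiv
  rw [h3, projL_inclL_projL hB hK hK' hle, hσ, innerL_inclL_sharpL hB hK']
  rfl

theorem smoothOnOrbit_grad : SmoothOnOrbit (W := E') (fun Z : adjointOrbit Λ =>
    (grad B K (fun Y => F (relProj B K K' Y)) (momentMap B K Z : LieAlg E' K) : LieAlg E' K))
      Set.univ := by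
  obtain ⟨σ, -, hσ⟩ := exists_grad_eq (Λ := Λ) hB hK hK' hle hF
  refine smoothOnOrbit_of_local fun Z _ =>
    ⟨fun z => σ (sharpL E'' K' B (fderiv ℝ F (projL E'' K' B z))), ?_,
      Eventually.of_forall fun Z' => hσ Z'⟩
  have h1 : ContDiff ℝ ∞ (fderiv ℝ F) := hF.fderiv_right (by simp)
  exact (σ.contDiff.comp ((sharpL E'' K' B).contDiff.comp
    (h1.comp (projL E'' K' B).contDiff))).contDiffAt

/-- The Lax equation for the moment map of `K`. -/
theorem hasDerivAt_momentMap {γ : ℝ → adjointOrbit Λ} {J : Set ℝ}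
    (hγ : IsTrajectoryOn B (fun Z => F (momentMap B K' Z)) γ J) {t : ℝ} (ht : t ∈ J) :
    HasDerivAt (fun τ => (momentMap B K (γ τ) : LieAlg E' K))
      (-⁅(momentMap B K (γ t) : LieAlg E' K),
        grad B K (fun Y => F (relProj B K K' Y)) (momentMap B K (γ t) : LieAlg E' K)⁆) t := by
  obtain ⟨σ, hσ, hgrad⟩ := exists_grad_eq (Λ := Λ) hB hK hK' hle hF
  have hH : HasLocalDiff (fun Z : adjointOrbit Λ => F (momentMap B K' Z)) (γ t) _ :=
    hasLocalDiff_of_momentMap hB hK' ((hF.differentiable (by simp)).differentiableAt)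
      (Eventually.of_forall fun Z' => congrArg F (momentMap_eq hB hK' Z'))
  have h1 : HasDerivAt (fun τ => ptL (γ τ)) _ t := hγ t ht
  rw [hamiltonianVectorField_eq hB hH (innerL_inclL_sharpL hB hK' _)] at h1
  have h2 := (projL E' K B).hasFDerivAt.comp_hasDerivAt t h1
  -- The velocity is `ad` of an element of 𝔨' ⊆ 𝔨 applied to γ, so the projection passes through it;
  -- skew symmetry supplies the sign.
  rw [← hσ, projL_adL hB hK, adL_skew] at h2
  have h3 : (-⁅(momentMap B K (γ t) : LieAlg E' K),
        grad B K (fun Y => F (relProj B K K' Y)) (momentMap B K (γ t) : LieAlg E' K)⁆) =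
      -adL E' K (projL E' K B (ptL (γ t)))
        (σ (sharpL E'' K' B (fderiv ℝ F (projL E'' K' B (ptL (γ t)))))) := by
    rw [bracket_eq_adL, hgrad]
    exact congrArg (fun v : E' => -adL E' K v _) (momentMap_eq hB hK (γ t))
  have h4 : (fun τ => (momentMap B K (γ τ) : LieAlg E' K)) =
      projL E' K B ∘ fun τ => ptL (γ τ) := by
    funext τ
    exact momentMap_eq hB hK (γ τ)
  rw [h3, h4]
  exact h2

end Moment

/-! ### Differentials of unitary representations -/

section Rep

variable {E : Type*} [NormedAddCommGroup E] [NormedSpace ℝ E] [FiniteDimensional ℝ E]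
  {K : Type*} [TopologicalSpace K] [ChartedSpace E K] [Group K] [LieGroup 𝓘(ℝ, E) ∞ K]
  {V : Type*} [NormedAddCommGroup V] [InnerProductSpace ℂ V] [FiniteDimensional ℂ V]
  {ϱ : Representation ℂ K V}

/-- A representation with values in the continuous operators. -/
def repL (ϱ : Representation ℂ K V) (k : K) : V →L[ℂ] V := LinearMap.toContinuousLinearMap (ϱ k)

/-- The induced representation of the Lie algebra, as a continuous linear map. -/
def tauL (E : Type*) [NormedAddCommGroup E] [NormedSpace ℝ E]
    {K : Type*} [TopologicalSpace K] [ChartedSpace E K] [Group K]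
    {V : Type*} [NormedAddCommGroup V] [InnerProductSpace ℂ V] [FiniteDimensional ℂ V]
    (ϱ : Representation ℂ K V) : E →L[ℝ] (V →L[ℂ] V) :=
  mder (repL ϱ) (1 : K)

theorem repL_mul (k h : K) : repL ϱ (k * h) = repL ϱ k * repL ϱ h := by
  ext v
  simp [repL]

theorem repL_one : repL ϱ 1 = 1 := by
  ext v
  simp [repL]

variable (V) in
/-- Composition of operators as a continuous real bilinear map. -/
def mulB : (V →L[ℂ] V) →L[ℝ] (V →L[ℂ] V) →L[ℝ] (V →L[ℂ] V) :=
  ContinuousLinearMap.mul ℝ (V →L[ℂ] V)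

variable (hϱ : IsIrreducibleUnitary (E := E) ϱ)
include hϱ

theorem mdifferentiableAt_repL (k : K) :
    MDifferentiableAt 𝓘(ℝ, E) 𝓘(ℝ, V →L[ℂ] V) (repL ϱ) k :=
  hϱ.smooth.mdifferentiableAt (by simp)

/-- Differentiate ϱ(k)ϱ(h) = ϱ(khk⁻¹)ϱ(k) in h at 1. -/
theorem tauL_AdL_mul (k : K) (X : E) :
    tauL E ϱ (AdL k X) * repL ϱ k = repL ϱ k * tauL E ϱ X := by
  have h1 : (fun h : K => mulB V (repL ϱ k) (repL ϱ h)) =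
      fun h => (mulB V).flip (repL ϱ k) ((repL ϱ ∘ fun h : K => k * h * k⁻¹) h) := by
    funext h
    change repL ϱ k * repL ϱ h = repL ϱ (k * h * k⁻¹) * repL ϱ k
    rw [← repL_mul, ← repL_mul]
    simp
  have e1 : k * 1 * k⁻¹ = 1 := by simp
  have hd : MDifferentiableAt 𝓘(ℝ, E) 𝓘(ℝ, V →L[ℂ] V) (repL ϱ) (k * 1 * k⁻¹) :=
    mdifferentiableAt_repL hϱ _
  have h2 := mder_clm_comp (mulB V (repL ϱ k)) (mdifferentiableAt_repL hϱ (1 : K))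
  rw [h1, mder_clm_comp _ (hd.comp (1 : K) (conj_mdifferentiable k 1)),
    mder_comp (1 : K) hd (conj_mdifferentiable k 1), e1] at h2
  exact congrArg (fun T : E →L[ℝ] (V →L[ℂ] V) => T X) h2

/-- The derivative in k at 1 of the identity `tauL_AdL_mul`. -/
theorem tauL_adL (X Y : E) :
    tauL E ϱ (adL E K X Y) = tauL E ϱ X * tauL E ϱ Y - tauL E ϱ Y * tauL E ϱ X := by
  have hY : MDifferentiableAt 𝓘(ℝ, E) 𝓘(ℝ, V →L[ℂ] V) (fun k : K => tauL E ϱ (AdL k Y)) 1 :=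
    MDifferentiableAt.comp (g := tauL E ϱ) (1 : K) (tauL E ϱ).mdifferentiableAt
      (mdifferentiableAt_AdL_apply Y 1)
  have h1 := mder_bilin (mulB V) hY (mdifferentiableAt_repL hϱ (1 : K)) X
  have h2 : (fun k : K => mulB V (tauL E ϱ (AdL k Y)) (repL ϱ k)) =
      fun k => (mulB V).flip (tauL E ϱ Y) (repL ϱ k) := by
    funext k
    exact tauL_AdL_mul hϱ k Y
  rw [h2, mder_clm_comp _ (mdifferentiableAt_repL hϱ (1 : K)),
    mder_clm_comp _ (mdifferentiableAt_AdL_apply Y 1), AdL_one, repL_one] at h1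
  simp only [ContinuousLinearMap.comp_apply, mder_AdL_apply] at h1
  have h3 : tauL E ϱ X * tauL E ϱ Y = tauL E ϱ Y * tauL E ϱ X + tauL E ϱ (adL E K X Y) * 1 := h1
  rw [h3, mul_one]
  abel

omit hϱ in
variable (V) in
/-- The hermitian inner product as a continuous real bilinear map. -/
def innerB : V →L[ℝ] V →L[ℝ] ℂ :=
  LinearMap.toContinuousBilinearMap (LinearMap.mk₂ ℝ (fun v w : V => (inner ℂ v w : ℂ))
    (fun _ _ _ => inner_add_left _ _ _) (fun _ _ _ => inner_smul_real_left _ _ _)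
    (fun _ _ _ => inner_add_right _ _ _) (fun _ _ _ => inner_smul_real_right _ _ _))

omit hϱ in
variable (V) in
/-- Evaluation of operators at a vector as a continuous real linear map. -/
def evalB (v : V) : (V →L[ℂ] V) →L[ℝ] V :=
  (ContinuousLinearMap.apply ℂ V v).restrictScalars ℝ

/-- The derivative at 1 of the constant function k ↦ ⟨ϱ(k)v, ϱ(k)w⟩. -/
theorem inner_tauL (X : E) (v w : V) :
    inner ℂ (tauL E ϱ X v) w = -inner ℂ v (tauL E ϱ X w) := by
  have hd : ∀ v : V, MDifferentiableAt 𝓘(ℝ, E) 𝓘(ℝ, V) (fun k : K => evalB V v (repL ϱ k)) 1 :=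
    fun v => MDifferentiableAt.comp (g := evalB V v) (1 : K) (evalB V v).mdifferentiableAt
      (mdifferentiableAt_repL hϱ 1)
  have h1 := mder_bilin (innerB V) (hd v) (hd w) X
  have h2 : (fun k : K => innerB V (evalB V v (repL ϱ k)) (evalB V w (repL ϱ k))) =
      fun _ => inner ℂ v w := by
    funext k
    exact hϱ.unitary k v w
  have h3 : (mder (fun _ : K => (inner ℂ v w : ℂ)) 1 : E →L[ℝ] ℂ) = 0 := mfderiv_const
  rw [h2, h3, mder_clm_comp _ (mdifferentiableAt_repL hϱ (1 : K)),
    mder_clm_comp _ (mdifferentiableAt_repL hϱ (1 : K)), repL_one] at h1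
  have h4 : (0 : ℂ) = inner ℂ v (tauL E ϱ X w) + inner ℂ (tauL E ϱ X v) w := h1
  rw [eq_neg_iff_add_eq_zero, add_comm, ← h4]

/-- The hermitian operator `-√-1 ϱ_*(X)`. -/
theorem isSymmetric_tauL (X : E) :
    ((-Complex.I) • tauL E ϱ X : V →L[ℂ] V).toLinearMap.IsSymmetric := by
  intro v w
  have h := inner_tauL hϱ X v w
  simp only [ContinuousLinearMap.coe_coe, smul_apply, inner_smul_left, inner_smul_right, h]
  simp

end Rep

/-! ### Continuity of sorted eigenvalues -/

section Weyl

variable {V : Type*} [NormedAddCommGroup V] [InnerProductSpace ℂ V] [FiniteDimensional ℂ V] {n : ℕ}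

theorem re_inner_eq_sum_eigenvalues {T : V →ₗ[ℂ] V} (hT : T.IsSymmetric)
    (hn : Module.finrank ℂ V = n) (x : V) :
    (inner ℂ (T x) x : ℂ).re =
      ∑ j, hT.eigenvalues hn j * ‖(inner ℂ (hT.eigenvectorBasis hn j) x : ℂ)‖ ^ 2 := by
  rw [← (hT.eigenvectorBasis hn).sum_inner_mul_inner, Complex.re_sum]
  refine Finset.sum_congr rfl fun j _ => ?_
  rw [hT, hT.apply_eigenvectorBasis, inner_smul_right, mul_assoc, ← inner_conj_symm]
  rw [mul_comm (starRingEnd ℂ _), Complex.mul_conj, Complex.normSq_eq_norm_sq]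
  change ((hT.eigenvalues hn j : ℂ) * _).re = _
  rw [← Complex.ofReal_mul, Complex.ofReal_re]

/-- Weyl's inequality for the sorted eigenvalues. -/
theorem eigenvalues_le_add {T S : V →ₗ[ℂ] V} (hT : T.IsSymmetric) (hS : S.IsSymmetric)
    (hn : Module.finrank ℂ V = n) {C : ℝ}
    (h : ∀ x, (inner ℂ (T x) x : ℂ).re ≤ (inner ℂ (S x) x : ℂ).re + C * ‖x‖ ^ 2) (a : Fin n) :
    hT.eigenvalues hn a ≤ hS.eigenvalues hn a + C := by
  set b := hT.eigenvectorBasis hn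
  set c := hS.eigenvectorBasis hn
  -- The kernel of `L` consists of the x orthogonal to b_j for j > a and to c_j for j < a: n - 1
  -- conditions, so some x ≠ 0 remains. As eigenvalues are sorted decreasingly, on x the form of T
  -- is at least its a-th eigenvalue times ‖x‖², and that of S at most its own.
  let L : V →ₗ[ℂ] ({j : Fin n // j ≠ a} → ℂ) :=
    LinearMap.pi fun j => if a < j.1 then (innerSL ℂ (b j.1)).toLinearMap
      else (innerSL ℂ (c j.1)).toLinearMap
  have hlt : Module.finrank ℂ ({j : Fin n // j ≠ a} → ℂ) < Module.finrank ℂ V := by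
    rw [Module.finrank_fintype_fun_eq_card, hn]
    simpa using Fintype.card_subtype_lt (p := fun j : Fin n => j ≠ a) (x := a) (by simp)
  obtain ⟨x, hx, hx0⟩ := (Submodule.ne_bot_iff _).mp (LinearMap.ker_ne_bot_of_finrank_lt (f := L) hlt)
  have hL : ∀ j (hj : j ≠ a), L x ⟨j, hj⟩ = 0 := fun j hj => by
    rw [LinearMap.mem_ker.mp hx]; rfl
  have hb : ∀ j, a < j → (inner ℂ (b j) x : ℂ) = 0 := fun j hj => by
    have := hL j hj.ne'
    simpa [L, hj] using this
  have hc : ∀ j, j < a → (inner ℂ (c j) x : ℂ) = 0 := fun j hj => by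
    have := hL j hj.ne
    simpa [L, hj.not_gt] using this
  have hxpos : 0 < ‖x‖ ^ 2 := by positivity
  have h1 : hT.eigenvalues hn a * ‖x‖ ^ 2 ≤ (inner ℂ (T x) x : ℂ).re := by
    rw [re_inner_eq_sum_eigenvalues hT hn, ← b.sum_sq_norm_inner_right x, Finset.mul_sum]
    refine Finset.sum_le_sum fun j _ => ?_
    rcases le_or_gt j a with hj | hj
    · exact mul_le_mul_of_nonneg_right (hT.eigenvalues_antitone hn hj) (by positivity)
    · rw [show (inner ℂ (hT.eigenvectorBasis hn j) x : ℂ) = 0 from hb j hj]; simp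
  have h2 : (inner ℂ (S x) x : ℂ).re ≤ hS.eigenvalues hn a * ‖x‖ ^ 2 := by
    rw [re_inner_eq_sum_eigenvalues hS hn, ← c.sum_sq_norm_inner_right x, Finset.mul_sum]
    refine Finset.sum_le_sum fun j _ => ?_
    rcases le_or_gt a j with hj | hj
    · exact mul_le_mul_of_nonneg_right (hS.eigenvalues_antitone hn hj) (by positivity)
    · rw [show (inner ℂ (hS.eigenvectorBasis hn j) x : ℂ) = 0 from hc j hj]; simp
  have h3 := h x
  nlinarith

/-- Weyl's inequality with C = ‖S x - S y‖, used in both directions, makes each sorted eigenvalue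
1-Lipschitz in the operator norm. -/
theorem continuous_eigenvalues {X : Type*} [TopologicalSpace X] {S : X → V →L[ℂ] V}
    (hS : Continuous S) (hsym : ∀ x, (S x).toLinearMap.IsSymmetric)
    (hn : Module.finrank ℂ V = n) (a : Fin n) :
    Continuous fun x => (hsym x).eigenvalues hn a := by
  have key : ∀ x y, (hsym x).eigenvalues hn a ≤ (hsym y).eigenvalues hn a + ‖S x - S y‖ := by
    intro x y
    refine eigenvalues_le_add _ _ hn (fun v => ?_) a
    have h1 : (inner ℂ ((S x - S y) v) v : ℂ).re ≤ ‖S x - S y‖ * ‖v‖ ^ 2 :=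
      calc _ ≤ ‖(inner ℂ ((S x - S y) v) v : ℂ)‖ := Complex.re_le_norm _
        _ ≤ ‖(S x - S y) v‖ * ‖v‖ := norm_inner_le_norm _ _
        _ ≤ (‖S x - S y‖ * ‖v‖) * ‖v‖ := by gcongr; exact (S x - S y).le_opNorm v
        _ = _ := by ring
    rw [sub_apply, inner_sub_left, Complex.sub_re] at h1
    simp only [ContinuousLinearMap.coe_coe]
    linarith
  rw [continuous_iff_continuousAt]
  intro x
  rw [ContinuousAt, tendsto_iff_dist_tendsto_zero]
  have h0 : Filter.Tendsto (fun y => ‖S y - S x‖) (nhds x) (nhds 0) := by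
    have := (hS.sub (continuous_const (y := S x))).norm.tendsto x
    simpa using this
  refine squeeze_zero (fun _ => dist_nonneg) (fun y => ?_) h0
  rw [Real.dist_eq, abs_le]
  have h1 := key x y
  have h2 := key y x
  rw [norm_sub_rev] at h1
  constructor <;> linarith

end Weyl

/-! ### Local constancy of coincidences -/

section Pattern

open Filter Topology

/-- The coincidence pattern of finitely many continuous functions is locally constant on an open
dense set. -/
theorem exists_isOpen_dense_pattern {X ι : Type*} [TopologicalSpace X] [Finite ι] {f : ι → X → ℝ}
    (hf : ∀ p, Continuous (f p)) :
    ∃ U : Set X, IsOpen U ∧ Dense U ∧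
      ∀ x ∈ U, ∀ᶠ y in 𝓝 x, ∀ p q, f p y = f q y ↔ f p x = f q x := by
  refine ⟨{x | ∀ᶠ y in 𝓝 x, ∀ p q, f p y = f q y ↔ f p x = f q x}, ?_, ?_, fun x hx => hx⟩
  · rw [isOpen_iff_mem_nhds]
    intro x hx
    filter_upwards [eventually_eventually_nhds.mpr hx, hx] with y hy hyx
    filter_upwards [hy] with z hz p q
    rw [hz, hyx]
  · have hev : ∀ x, ∀ᶠ y in 𝓝 x, ∀ p q, f p x ≠ f q x → f p y ≠ f q y := by
      intro x
      simp only [eventually_all]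
      intro p q h
      exact (isOpen_ne_fun (hf p) (hf q)).mem_nhds h
    -- Inequalities persist nearby, so the set of unequal pairs can only grow. At a point of W where
    -- its size is maximal it cannot grow, so it is locally constant there.
    let N : X → ℕ := fun x => {pq : ι × ι | f pq.1 x ≠ f pq.2 x}.ncard
    rw [dense_iff_inter_open]
    intro W hW hWne
    have hbdd : BddAbove (N '' W) := by
      refine ⟨Nat.card (ι × ι), ?_⟩
      rintro _ ⟨x, -, rfl⟩
      exact Set.ncard_le_card _
    obtain ⟨x, hxW, hx⟩ := Nat.sSup_mem (hWne.image N) hbdd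
    refine ⟨x, hxW, ?_⟩
    filter_upwards [hev x, hW.mem_nhds hxW] with y hy hyW p q
    have hsub : {pq : ι × ι | f pq.1 x ≠ f pq.2 x} ⊆ {pq : ι × ι | f pq.1 y ≠ f pq.2 y} :=
      fun pq h => hy _ _ h
    have hle : N y ≤ N x := by
      rw [hx]
      exact le_csSup hbdd ⟨y, hyW, rfl⟩
    have heq := Set.eq_of_subset_of_ncard_le hsub hle (Set.toFinite _)
    have := Set.ext_iff.mp heq (p, q)
    simp only [Set.mem_ofPred_eq] at this
    tauto

end Pattern

/-! ### Smooth dependence of roots of constant multiplicity -/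

section Roots

open Filter Topology Polynomial

variable {E : Type*} [NormedAddCommGroup E] [NormedSpace ℝ E] {n : ℕ}

/-- The monic polynomial with the given roots. -/
def rootsPoly (l : Fin n → ℝ) : ℝ[X] := ∏ b, (X - C (l b))

theorem rootsPoly_ne_zero (l : Fin n → ℝ) : rootsPoly l ≠ 0 :=
  (monic_prod_of_monic _ _ fun b _ => monic_X_sub_C (l b)).ne_zero

theorem rootMultiplicity_rootsPoly (l : Fin n → ℝ) (t : ℝ) :
    (rootsPoly l).rootMultiplicity t = (Finset.univ.filter fun b => l b = t).card := by
  classical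
  rw [← count_roots, rootsPoly, roots_prod _ _ (Finset.prod_ne_zero_iff.mpr fun b _ => X_sub_C_ne_zero _)]
  simp_rw [roots_X_sub_C]
  rw [Multiset.bind_singleton, Multiset.count_map, Finset.card_def, Finset.filter_val]
  simp_rw [eq_comm]

/-- Only the value of the polynomial is assumed smooth, not the roots; its derivatives in the
variable are partial derivatives of that value. -/
theorem contDiff_iterate_derivative {l : E → Fin n → ℝ}
    (h : ContDiff ℝ ∞ fun z : E × ℝ => (rootsPoly (l z.1)).eval z.2) (k : ℕ) :
    ContDiff ℝ ∞ fun z : E × ℝ => (derivative^[k] (rootsPoly (l z.1))).eval z.2 := by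
  induction k with
  | zero => exact h
  | succ k ih =>
    have h1 : (fun z : E × ℝ => (derivative^[k + 1] (rootsPoly (l z.1))).eval z.2) =
        fun z => fderiv ℝ (fun z : E × ℝ => (derivative^[k] (rootsPoly (l z.1))).eval z.2) z
          (0, 1) := by
      funext z
      have h2 := (ih.differentiable (by simp) z).hasFDerivAt.comp_hasDerivAt (f := fun t => (z.1, t))
        z.2 ((hasDerivAt_const z.2 z.1).prodMk (hasDerivAt_id z.2))
      have h3 := (derivative^[k] (rootsPoly (l z.1))).hasDerivAt z.2
      rw [Function.iterate_succ_apply']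
      exact h3.unique h2
    rw [h1]
    exact (ih.fderiv_right (m := ∞) (by simp)).clm_apply contDiff_const

/-- Where its multiplicity is constant, a root depends smoothly on the parameters. -/
theorem exists_smooth_root {l : E → Fin n → ℝ} [CompleteSpace E]
    (h : ContDiff ℝ ∞ fun z : E × ℝ => (rootsPoly (l z.1)).eval z.2) (a : Fin n)
    (hl : Continuous fun y => l y a) (y₀ : E) :
    ∃ g : E → ℝ, ContDiffAt ℝ ∞ g y₀ ∧ ∀ᶠ y in 𝓝 y₀,
      (∀ b, l y b = l y a ↔ l y₀ b = l y₀ a) → l y a = g y := by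
  set m := (rootsPoly (l y₀)).rootMultiplicity (l y₀ a) with hm
  have hm0 : 0 < m := by
    rw [hm, rootMultiplicity_rootsPoly, Finset.card_pos]
    exact ⟨a, by simp⟩
  -- A root of multiplicity m is a simple root of the (m-1)-st derivative, to which the implicit
  -- function theorem applies.
  set f : E × ℝ → ℝ := fun z => (derivative^[m - 1] (rootsPoly (l z.1))).eval z.2 with hf
  have hroot : ∀ y, (rootsPoly (l y)).rootMultiplicity (l y a) = m → f (y, l y a) = 0 := by
    intro y hy
    exact isRoot_iterate_derivative_of_lt_rootMultiplicity (by rw [hy]; exact Nat.sub_lt hm0 one_pos)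
  have hfs : ContDiff ℝ ∞ f := contDiff_iterate_derivative h _
  have hder : (derivative^[m] (rootsPoly (l y₀))).eval (l y₀ a) ≠ 0 := by
    intro h0
    have h1 : m < (rootsPoly (l y₀)).rootMultiplicity (l y₀ a) := by
      rw [lt_rootMultiplicity_iff_isRoot_iterate_derivative (rootsPoly_ne_zero _)]
      intro k hk
      rcases hk.lt_or_eq with hk | rfl
      · exact isRoot_iterate_derivative_of_lt_rootMultiplicity hk
      · exact h0
    exact lt_irrefl _ h1
  have hD : fderiv ℝ f (y₀, l y₀ a) (0, 1) = (derivative^[m] (rootsPoly (l y₀))).eval (l y₀ a) := by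
    have h2 := (hfs.differentiable (by simp) (y₀, l y₀ a)).hasFDerivAt.comp_hasDerivAt
      (f := fun t => (y₀, t)) (l y₀ a)
      ((hasDerivAt_const (l y₀ a) y₀).prodMk (hasDerivAt_id (l y₀ a)))
    have h3 := (derivative^[m - 1] (rootsPoly (l y₀))).hasDerivAt (l y₀ a)
    have e : derivative (derivative^[m - 1] (rootsPoly (l y₀))) =
        derivative^[m] (rootsPoly (l y₀)) := by
      rw [← Function.iterate_succ_apply' derivative, Nat.succ_eq_add_one, Nat.sub_add_cancel hm0]
    rw [e] at h3
    exact h2.unique h3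
  have hinv : (fderiv ℝ f (y₀, l y₀ a) ∘L .inr ℝ E ℝ).IsInvertible := by
    refine ⟨ContinuousLinearEquiv.unitsEquivAut ℝ (Units.mk0 _ hder), ?_⟩
    ext
    simp [hD]
  have hc : ContDiffAt ℝ ∞ f (y₀, l y₀ a) := hfs.contDiffAt
  refine ⟨hc.implicitFunction (by simp) hinv, hc.contDiffAt_implicitFunction (by simp) hinv, ?_⟩
  have hev := hc.eventually_apply_eq_iff_implicitFunction (by simp) hinv
  have ht : Tendsto (fun y => (y, l y a)) (𝓝 y₀) (𝓝 (y₀, l y₀ a)) :=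
    (continuous_id.prodMk hl).tendsto y₀
  filter_upwards [ht.eventually hev] with y hy hpat
  refine (hy.mp ?_).symm
  -- What remains is that the multiplicity at y is still m; it counts the indices coinciding with
  -- `a`, which the pattern fixes.
  rw [hroot y₀ rfl, hroot y]
  rw [hm, rootMultiplicity_rootsPoly, rootMultiplicity_rootsPoly]
  simp only [hpat]

end Roots

/-! ### Characteristic polynomials over ℝ of complex operators -/

section Charpoly

open Polynomial

/-- The real determinant of a complex operator is the norm from ℂ to ℝ of its complex determinant.
-/
theorem charpoly_restrictScalars_eval {M : Type*} [AddCommGroup M] [Module ℂ M] [Module ℝ M]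
    [IsScalarTower ℝ ℂ M] [FiniteDimensional ℂ M] [FiniteDimensional ℝ M] (f : M →ₗ[ℂ] M) (t : ℝ) :
    (f.restrictScalars ℝ).charpoly.eval t = Complex.normSq (f.charpoly.eval (t : ℂ)) := by
  rw [LinearMap.eval_charpoly, LinearMap.eval_charpoly, ← Algebra.norm_complex_apply,
    ← LinearMap.det_restrictScalars]
  congr 1
  refine LinearMap.ext fun v => ?_
  exact congrArg (fun w => w - f v) (algebraMap_smul ℂ t v).symm

theorem charpoly_of_diagonal {R M ι : Type*} [CommRing R] [Nontrivial R] [AddCommGroup M]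
    [Module R M] [Module.Free R M] [Module.Finite R M]
    [Fintype ι] (b : Module.Basis ι R M) {f : M →ₗ[R] M} {d : ι → R} (h : ∀ p, f (b p) = d p • b p) :
    f.charpoly = ∏ p, (X - C (d p)) := by
  classical
  have h1 : LinearMap.toMatrix b b f = Matrix.diagonal d := by
    ext p q
    rw [LinearMap.toMatrix_apply, h, map_smul, b.repr_self, Finsupp.smul_apply,
      Finsupp.single_apply, Matrix.diagonal_apply]
    by_cases hpq : p = q
    · simp [hpq]
    · simp [hpq, Ne.symm hpq]
  rw [← LinearMap.charpoly_toMatrix f b, h1, Matrix.charpoly_diagonal]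

variable {s : Type*} [Fintype s] {V : s → Type*} [∀ i, NormedAddCommGroup (V i)]
  [∀ i, InnerProductSpace ℂ (V i)] [∀ i, FiniteDimensional ℂ (V i)]

/-- The characteristic polynomial of a direct sum of skew-hermitian operators as a real
operator. -/
theorem charpoly_directSum (T : ∀ i, V i →L[ℂ] V i)
    (hT : ∀ i, ((-Complex.I) • T i : V i →L[ℂ] V i).toLinearMap.IsSymmetric) :
    (directSum T).charpoly = ∏ p : Σ i, Fin (Module.finrank ℂ (V i)),
      (X ^ 2 + C ((hT p.1).eigenvalues rfl p.2 ^ 2)) := by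
  classical
  let d : Module.Basis (Σ i, Fin (Module.finrank ℂ (V i))) ℂ (∀ i, V i) :=
    Pi.basis fun i => ((hT i).eigenvectorBasis rfl).toBasis
  let f : (∀ i, V i) →ₗ[ℂ] (∀ i, V i) :=
    LinearMap.pi fun i => (T i).toLinearMap ∘ₗ LinearMap.proj i
  have hf : f.charpoly = ∏ p : Σ i, Fin (Module.finrank ℂ (V i)),
      (X - C (Complex.I * ((hT p.1).eigenvalues rfl p.2 : ℂ))) := by
    refine charpoly_of_diagonal d ?_
    rintro ⟨i, a⟩
    have h1 := (hT i).apply_eigenvectorBasis rfl a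
    have h2 : T i ((hT i).eigenvectorBasis rfl a) =
        (Complex.I * ((hT i).eigenvalues rfl a : ℂ)) • (hT i).eigenvectorBasis rfl a := by
      have h3 := congrArg (fun v => Complex.I • v) h1
      simp only [ContinuousLinearMap.coe_coe, smul_apply, smul_smul] at h3
      simpa using h3
    have h4 : d ⟨i, a⟩ = Pi.single i ((hT i).eigenvectorBasis rfl a) := by
      simp [d, Pi.basis_apply]
    rw [h4]
    funext j
    by_cases hj : j = i
    · subst hj
      simpa [f] using h2
    · simp [f, hj]
  -- At real t the real polynomial is the product of the |t - √-1 λ|² = t² + λ².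
  refine Polynomial.funext fun t => ?_
  have h5 := charpoly_restrictScalars_eval f t
  refine h5.trans ?_
  rw [hf, eval_prod, eval_prod, map_prod]
  refine Finset.prod_congr rfl fun p _ => ?_
  simp [Complex.normSq_apply]
  ring

end Charpoly

/-! ### Smoothness of the characteristic polynomial -/

section Smooth

open Polynomial

variable {E : Type*} [NormedAddCommGroup E] [NormedSpace ℝ E]
  {V : Type*} [NormedAddCommGroup V] [InnerProductSpace ℂ V] [FiniteDimensional ℂ V]

/-- Although single eigenvalues are merely continuous, this product is det(t - S y), polynomial in t
and the matrix entries; it is real, so taking the real part loses nothing. -/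
theorem contDiff_rootsPoly_eigenvalues (S : E →L[ℝ] (V →L[ℂ] V))
    (hS : ∀ y, (S y).toLinearMap.IsSymmetric) :
    ContDiff ℝ ∞ fun z : E × ℝ =>
      (rootsPoly ((hS z.1).eigenvalues (rfl : Module.finrank ℂ V = _))).eval z.2 := by
  let b := Module.finBasis ℂ V
  have h1 : (fun z : E × ℝ =>
      (rootsPoly ((hS z.1).eigenvalues (rfl : Module.finrank ℂ V = _))).eval z.2) =
      fun z => Complex.reCLM
        (Matrix.scalar _ (z.2 : ℂ) - LinearMap.toMatrix b b (S z.1).toLinearMap).det := by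
    funext z
    rw [← Matrix.eval_charpoly, LinearMap.charpoly_toMatrix, (hS z.1).charpoly_eq rfl, rootsPoly,
      eval_prod, eval_prod]
    refine (Complex.ofReal_re _).symm.trans (congrArg Complex.re ?_)
    rw [Complex.ofReal_prod]
    refine Finset.prod_congr rfl fun a _ => ?_
    rw [eval_sub, eval_sub, eval_X, eval_X, eval_C, eval_C, Complex.ofReal_sub]
    rfl
  rw [h1]
  refine Complex.reCLM.contDiff.comp ?_
  simp only [Matrix.det_apply]
  refine ContDiff.sum fun σ _ => ContDiff.const_smul _ (contDiff_prod fun i _ => ?_)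
  simp only [Matrix.sub_apply, LinearMap.toMatrix_apply, Matrix.scalar_apply,
    Matrix.diagonal_apply]
  refine ContDiff.sub ?_ ?_
  · split_ifs
    · exact Complex.ofRealCLM.contDiff.comp contDiff_snd
    · exact contDiff_const
  · let c : (V →L[ℂ] V) →L[ℝ] ℂ :=
      (LinearMap.toContinuousLinearMap (b.coord (σ i))).restrictScalars ℝ ∘L evalB V (b i)
    exact (c.comp S).contDiff.comp contDiff_fst

end Smooth

/-! ### Eigenvalues of a representation as invariant functions -/

section RepEigenvalues

open Filter Topology Polynomial

variable {E : Type*} [NormedAddCommGroup E] [NormedSpace ℝ E] [FiniteDimensional ℝ E]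
  {K : Type*} [TopologicalSpace K] [ChartedSpace E K] [Group K] [LieGroup 𝓘(ℝ, E) ∞ K]
  {V : Type*} [NormedAddCommGroup V] [InnerProductSpace ℂ V] [FiniteDimensional ℂ V]
  {ϱ : Representation ℂ K V} (hϱ : IsIrreducibleUnitary (E := E) ϱ)

variable (E ϱ) in
/-- The hermitian operators `-√-1 ϱ_*(X)`, as a real linear function of `X`. -/
def hermL : E →L[ℝ] (V →L[ℂ] V) :=
  ((-Complex.I) • ContinuousLinearMap.id ℂ (V →L[ℂ] V)).restrictScalars ℝ ∘L tauL E ϱ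

omit [FiniteDimensional ℝ E] [LieGroup 𝓘(ℝ, E) ∞ K] in
theorem hermL_apply (X : E) : hermL E ϱ X = (-Complex.I) • tauL E ϱ X := rfl

include hϱ in
theorem isSymmetric_hermL (X : E) : (hermL E ϱ X).toLinearMap.IsSymmetric :=
  isSymmetric_tauL hϱ X

/-- The sorted eigenvalues of `-√-1 ϱ_*(X)`. -/
def repEigenvalue (X : E) : Fin (Module.finrank ℂ V) → ℝ :=
  (isSymmetric_hermL hϱ X).eigenvalues rfl

theorem continuous_repEigenvalue (a : Fin (Module.finrank ℂ V)) :
    Continuous fun X : E => repEigenvalue hϱ X a :=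
  continuous_eigenvalues (hermL E ϱ).continuous (isSymmetric_hermL hϱ) rfl a

/-- The operators at X and at Ad(k)X are conjugate by ϱ(k), and the characteristic polynomial
determines the sorted eigenvalues. -/
theorem repEigenvalue_AdL (k : K) (X : E) :
    repEigenvalue hϱ (AdL k X) = repEigenvalue hϱ X := by
  refine (LinearMap.IsSymmetric.eigenvalues_eq_eigenvalues_iff _ rfl _ rfl).mpr ?_
  have hinv : ∀ k : K, ϱ k * ϱ k⁻¹ = 1 := fun k => by rw [← map_mul, mul_inv_cancel, map_one]
  have hinv' : ∀ k : K, ϱ k⁻¹ * ϱ k = 1 := fun k => by rw [← map_mul, inv_mul_cancel, map_one]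
  let e : V ≃ₗ[ℂ] V := LinearEquiv.ofLinearMap (ϱ k) (ϱ k⁻¹) (hinv k) (hinv' k)
  rw [← e.charpoly_conj (hermL E ϱ X).toLinearMap]
  congr 1
  ext v
  have h1 := congrArg (fun T : V →L[ℂ] V => T (ϱ k⁻¹ v)) (tauL_AdL_mul hϱ k X)
  have h2 : ϱ k (ϱ k⁻¹ v) = v := congrArg (fun T : V →ₗ[ℂ] V => T v) (hinv k)
  have h3 : tauL E ϱ (AdL k X) (ϱ k (ϱ k⁻¹ v)) = ϱ k (tauL E ϱ X (ϱ k⁻¹ v)) := h1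
  rw [h2] at h3
  simp [LinearEquiv.conj_apply, e, h3, hermL_apply]

theorem exists_smooth_repEigenvalue (a : Fin (Module.finrank ℂ V)) (Y : E) :
    ∃ g : E → ℝ, ContDiffAt ℝ ∞ g Y ∧ ∀ᶠ X in 𝓝 Y,
      (∀ b, repEigenvalue hϱ X b = repEigenvalue hϱ X a ↔
        repEigenvalue hϱ Y b = repEigenvalue hϱ Y a) → repEigenvalue hϱ X a = g X := by
  have := FiniteDimensional.complete ℝ E
  have h : ContDiff ℝ ∞ fun z : E × ℝ => (rootsPoly (repEigenvalue hϱ z.1)).eval z.2 :=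
    contDiff_rootsPoly_eigenvalues (hermL E ϱ) (isSymmetric_hermL hϱ)
  exact exists_smooth_root (l := repEigenvalue hϱ) h a (continuous_repEigenvalue hϱ a) Y

end RepEigenvalues

/-! ### The matrix of the direct sum and its spectrum -/

section SumRep

open Polynomial

variable {s : Type*} [Fintype s] {E : s → Type*} [∀ i, NormedAddCommGroup (E i)]
  [∀ i, NormedSpace ℝ (E i)] [∀ i, FiniteDimensional ℝ (E i)]
  {K : s → Type*} [∀ i, TopologicalSpace (K i)] [∀ i, ChartedSpace (E i) (K i)]
  [∀ i, Group (K i)] [∀ i, LieGroup 𝓘(ℝ, E i) ∞ (K i)]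
  {V : s → Type*} [∀ i, NormedAddCommGroup (V i)]
  [∀ i, InnerProductSpace ℂ (V i)] [∀ i, FiniteDimensional ℂ (V i)]
  {n : Type*} [Fintype n] [DecidableEq n]

theorem directSum_add (S T : ∀ i, V i →L[ℂ] V i) :
    directSum (fun i => S i + T i) = directSum S + directSum T := rfl

theorem directSum_sub (S T : ∀ i, V i →L[ℂ] V i) :
    directSum (fun i => S i - T i) = directSum S - directSum T := rfl

theorem directSum_mul (S T : ∀ i, V i →L[ℂ] V i) :
    directSum (fun i => S i * T i) = directSum S ∘ₗ directSum T := rfl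

theorem directSum_smul (c : ℝ) (T : ∀ i, V i →L[ℂ] V i) :
    directSum (fun i => c • T i) = c • directSum T := rfl

/-- The matrix of the direct sum of the induced representations. -/
def sumMat (E : s → Type*) [∀ i, NormedAddCommGroup (E i)]
    [∀ i, NormedSpace ℝ (E i)]
    {K : s → Type*} [∀ i, TopologicalSpace (K i)] [∀ i, ChartedSpace (E i) (K i)]
    [∀ i, Group (K i)] (ϱ : ∀ i, Representation ℂ (K i) (V i))
    (b : Module.Basis n ℝ (∀ i, V i)) (Y : ∀ i, E i) : Matrix n n ℝ :=
  LinearMap.toMatrix b b (directSum fun i => tauL (E i) (ϱ i) (Y i))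

/-- The matrix of the direct sum of the induced representations, as a continuous linear map. -/
def sumRep (E : s → Type*) [∀ i, NormedAddCommGroup (E i)]
    [∀ i, NormedSpace ℝ (E i)] [∀ i, FiniteDimensional ℝ (E i)]
    {K : s → Type*} [∀ i, TopologicalSpace (K i)] [∀ i, ChartedSpace (E i) (K i)]
    [∀ i, Group (K i)] (ϱ : ∀ i, Representation ℂ (K i) (V i))
    (b : Module.Basis n ℝ (∀ i, V i)) : (∀ i, E i) →L[ℝ] (n → n → ℝ) :=
  LinearMap.toContinuousLinearMap
    { toFun := sumMat E ϱ b
      map_add' := fun X Y => by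
        simp only [sumMat, Pi.add_apply, map_add, directSum_add]
        rfl
      map_smul' := fun c X => by
        simp only [sumMat, Pi.smul_apply, map_smul, directSum_smul]
        rfl }

variable {ϱ : ∀ i, Representation ℂ (K i) (V i)}
  (hϱ : ∀ i, IsIrreducibleUnitary (E := E i) (ϱ i))
include hϱ

theorem sumMat_adL (b : Module.Basis n ℝ (∀ i, V i)) (X Y : ∀ i, E i) :
    sumMat E ϱ b (fun i => adL (E i) (K i) (X i) (Y i)) =
      ⁅sumMat E ϱ b X, sumMat E ϱ b Y⁆ := by
  rw [Ring.lie_def]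
  simp only [sumMat, ← LinearMap.toMatrix_mul]
  rw [Module.End.mul_eq_comp, Module.End.mul_eq_comp, ← directSum_mul, ← directSum_mul,
    ← map_sub (LinearMap.toMatrix b b), ← directSum_sub]
  simp only [tauL_adL (hϱ _)]

theorem hasDerivAt_sumMat (b : Module.Basis n ℝ (∀ i, V i)) {φ p : ℝ → ∀ i, E i} {t : ℝ}
    (h : ∀ i, HasDerivAt (fun τ => φ τ i) (-adL (E i) (K i) (φ t i) (p t i)) t) :
    HasDerivAt (fun τ => sumMat E ϱ b (φ τ)) (-⁅sumMat E ϱ b (φ t), sumMat E ϱ b (p t)⁆) t := by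
  have h1 := (sumRep E ϱ b).hasFDerivAt.comp_hasDerivAt t (hasDerivAt_pi.mpr h)
  rw [← sumMat_adL hϱ b]
  have h2 := map_neg (sumRep E ϱ b) fun i => adL (E i) (K i) (φ t i) (p t i)
  exact h2 ▸ h1

/-- The signs `±1`. -/
def sgn (e : Fin 2) : ℝ := if e = 0 then 1 else -1

/-- Each factor X² + λ² splits as (X - √-1 λ)(X + √-1 λ); the `Fin 2` component of the index chooses
the sign. -/
theorem roots_charpoly_sumMat {r : ℕ} (b : Module.Basis (Fin r) ℝ (∀ i, V i))
    (e : (Fin 2 × Σ i, Fin (Module.finrank ℂ (V i))) ≃ Fin r) (Y : ∀ i, E i) :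
    ((Matrix.map (sumMat E ϱ b Y) (algebraMap ℝ ℂ)).charpoly).roots =
      Finset.univ.val.map fun j => Complex.I * ((sgn (e.symm j).1 *
        repEigenvalue (hϱ (e.symm j).2.1) (Y (e.symm j).2.1) (e.symm j).2.2 : ℝ) : ℂ) := by
  have h1 : (sumMat E ϱ b Y).charpoly =
      ∏ p : Σ i, Fin (Module.finrank ℂ (V i)),
        (X ^ 2 + C (repEigenvalue (hϱ p.1) (Y p.1) p.2 ^ 2)) := by
    rw [sumMat, LinearMap.charpoly_toMatrix]
    exact charpoly_directSum (fun i => tauL (E i) (ϱ i) (Y i)) fun i => isSymmetric_tauL (hϱ i) (Y i)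
  have h2 : (Matrix.map (sumMat E ϱ b Y) (algebraMap ℝ ℂ)).charpoly =
      ∏ j, (X - C (Complex.I * ((sgn (e.symm j).1 *
        repEigenvalue (hϱ (e.symm j).2.1) (Y (e.symm j).2.1) (e.symm j).2.2 : ℝ) : ℂ))) := by
    rw [Matrix.charpoly_map, h1, Polynomial.map_prod,
      e.symm.prod_comp fun q => X - C (Complex.I * ((sgn q.1 *
        repEigenvalue (hϱ q.2.1) (Y q.2.1) q.2.2 : ℝ) : ℂ)), Fintype.prod_prod_type,
      Fin.prod_univ_two, ← Finset.prod_mul_distrib]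
    refine Finset.prod_congr rfl fun p _ => ?_
    simp only [sgn]
    have hI : (C Complex.I : ℂ[X]) ^ 2 = -1 := by
      rw [← C_pow, Complex.I_sq]
      simp
    simp only [Polynomial.map_add, Polynomial.map_pow, map_X, map_C, map_mul, map_pow,
      Complex.ofReal_mul, Complex.coe_algebraMap]
    simp
    linear_combination (C ((repEigenvalue (hϱ p.1) (Y p.1) p.2 : ℝ) : ℂ)) ^ 2 * hI
  rw [h2, roots_prod _ _ (Finset.prod_ne_zero_iff.mpr fun j _ => X_sub_C_ne_zero _)]
  simp_rw [roots_X_sub_C]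
  rw [Multiset.bind_singleton]

end SumRep

/-! ### Eigenvalues composed with moment maps -/

section Spectrum

open Topology Filter

variable {E : Type*} [NormedAddCommGroup E] [NormedSpace ℝ E] [FiniteDimensional ℝ E]
  {G : Type*} [TopologicalSpace G] [ChartedSpace E G] [Group G] [LieGroup 𝓘(ℝ, E) ∞ G]
  {Λ : LieAlg E G}
  {E' : Type*} [NormedAddCommGroup E'] [NormedSpace ℝ E'] [FiniteDimensional ℝ E']
  {K : Subgroup G} [ChartedSpace E' K] [LieGroup 𝓘(ℝ, E') ∞ K]
  {B : LinearMap.BilinForm ℝ (LieAlg E G)}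
  {V : Type*} [NormedAddCommGroup V] [InnerProductSpace ℂ V] [FiniteDimensional ℂ V]
  {ϱ : Representation ℂ K V} (hϱ : IsIrreducibleUnitary (E := E') ϱ)

theorem continuous_projL_ptL : Continuous fun Z : adjointOrbit Λ => projL E' K B (ptL Z) :=
  (projL E' K B).continuous.comp continuous_ptL

/-- An eigenvalue of a representation of `K` composed with the moment map of `K`. -/
def orbitEigenvalue (B : LinearMap.BilinForm ℝ (LieAlg E G))
    (hϱ : IsIrreducibleUnitary (E := E') ϱ)
    (a : Fin (Module.finrank ℂ V)) (Z : adjointOrbit Λ) : ℝ :=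
  repEigenvalue hϱ (projL E' K B (ptL Z)) a

theorem continuous_orbitEigenvalue (a : Fin (Module.finrank ℂ V)) :
    Continuous (orbitEigenvalue B hϱ a : adjointOrbit Λ → ℝ) :=
  (continuous_repEigenvalue hϱ a).comp continuous_projL_ptL

/-- The pattern is known only along the orbit, whose image in 𝔨 need not be open. For this reason
`exists_smooth_repEigenvalue` requires it pointwise, at each nearby X separately. -/
theorem exists_smooth_orbitEigenvalue (a : Fin (Module.finrank ℂ V)) (Z : adjointOrbit Λ)
    (hZ : ∀ᶠ Z' in 𝓝 Z, ∀ b, orbitEigenvalue B hϱ b Z' = orbitEigenvalue B hϱ a Z' ↔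
      orbitEigenvalue B hϱ b Z = orbitEigenvalue B hϱ a Z) :
    ∃ g : E' → ℝ, ContDiffAt ℝ ∞ g (projL E' K B (ptL Z)) ∧
      orbitEigenvalue B hϱ a =ᶠ[𝓝 Z] fun Z' => g (projL E' K B (ptL Z')) := by
  obtain ⟨g, hg, hg'⟩ := exists_smooth_repEigenvalue hϱ a (projL E' K B (ptL Z))
  refine ⟨g, hg, ?_⟩
  have hc : ContinuousAt (fun Z : adjointOrbit Λ => projL E' K B (ptL Z)) Z :=
    continuous_projL_ptL.continuousAt
  filter_upwards [hZ, hc.eventually hg'] with Z' h1 h2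
  exact h2 h1

theorem orbitEigenvalue_orbitAct (hB : IsAdInvariantInner B)
    (hK : Manifold.IsSmoothEmbedding 𝓘(ℝ, E') 𝓘(ℝ, E) ∞ (Subtype.val : K → G))
    (a : Fin (Module.finrank ℂ V)) (k : K) (Z : adjointOrbit Λ) :
    orbitEigenvalue B hϱ a (orbitAct (k : G) Z) = orbitEigenvalue B hϱ a Z := by
  rw [orbitEigenvalue, ptL_orbitAct, projL_AdL hB hK, repEigenvalue_AdL]
  rfl

/-- Invariant functions of the moment maps of two nested subgroups Poisson commute. -/
theorem poissonBracket_eq_zero_of_invariant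
    {E'' : Type*} [NormedAddCommGroup E''] [NormedSpace ℝ E''] [FiniteDimensional ℝ E'']
    {K' : Subgroup G} [ChartedSpace E'' K'] [LieGroup 𝓘(ℝ, E'') ∞ K']
    (hB : IsAdInvariantInner B)
    (hK : Manifold.IsSmoothEmbedding 𝓘(ℝ, E') 𝓘(ℝ, E) ∞ (Subtype.val : K → G))
    (hK' : Manifold.IsSmoothEmbedding 𝓘(ℝ, E'') 𝓘(ℝ, E) ∞ (Subtype.val : K' → G))
    (hle : K' ≤ K ∨ K ≤ K')
    {f h : adjointOrbit Λ → ℝ} {Z : adjointOrbit Λ} {F : E'' → ℝ}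
    (hF : DifferentiableAt ℝ F (projL E'' K' B (ptL Z)))
    (hf : f =ᶠ[𝓝 Z] fun Z' => F (projL E'' K' B (ptL Z')))
    (hfinv : ∀ (k : K') (Z' : adjointOrbit Λ), f (orbitAct (k : G) Z') = f Z')
    {F' : E' → ℝ} (hF' : DifferentiableAt ℝ F' (projL E' K B (ptL Z)))
    (hh : h =ᶠ[𝓝 Z] fun Z' => F' (projL E' K B (ptL Z')))
    (hhinv : ∀ (k : K) (Z' : adjointOrbit Λ), h (orbitAct (k : G) Z') = h Z') :
    poissonBracket B f h Z = 0 := by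
  rcases hle with hle | hle
  · exact poissonBracket_eq_zero hB hK hK' hle hF hf hF' hh hhinv
  · rw [poissonBracket_skew hB (hasLocalDiff_of_momentMap hB hK' hF hf)
      (hasLocalDiff_of_momentMap hB hK hF' hh)
      (a := inclL E E'' K' (sharpL E'' K' B (fderiv ℝ F (projL E'' K' B (ptL Z)))))
      (fun w => innerL_inclL_sharpL hB hK' _ w)
      (b := inclL E E' K (sharpL E' K B (fderiv ℝ F' (projL E' K B (ptL Z)))))
      (fun w => innerL_inclL_sharpL hB hK _ w),
      poissonBracket_eq_zero hB hK' hK hle hF' hh hF hf hfinv, neg_zero]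

end Spectrum

end GelfandTsetlinLax

end

/-! ### The main theorem -/

open GelfandTsetlinLax in
theorem corollary4p4
    -- the compact connected Lie group `G` with an `Ad`-invariant inner product `B`
    {E₀ : Type*} [NormedAddCommGroup E₀] [NormedSpace ℝ E₀] [FiniteDimensional ℝ E₀]
    {G : Type*} [TopologicalSpace G] [ChartedSpace E₀ G] [Group G] [LieGroup 𝓘(ℝ, E₀) ∞ G]
    [T2Space G] [CompactSpace G] [ConnectedSpace G]
    (B : LinearMap.BilinForm ℝ (LieAlg E₀ G)) (hB : IsAdInvariantInner B)
    (Λ : LieAlg E₀ G)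
    -- the chain of closed connected Lie subgroups `G = K 0 ⊇ K 1 ⊇ ... ⊇ K s`
    (s : ℕ) (K : Fin (s + 1) → Subgroup G) (hK0 : K 0 = ⊤) (hK : Antitone K)
    (hKclosed : ∀ i, IsClosed (K i : Set G)) (hKconn : ∀ i, IsConnected (K i : Set G))
    {E : Fin (s + 1) → Type*} [∀ i, NormedAddCommGroup (E i)] [∀ i, NormedSpace ℝ (E i)]
    [∀ i, FiniteDimensional ℝ (E i)]
    [∀ i, ChartedSpace (E i) (K i)] [∀ i, LieGroup 𝓘(ℝ, E i) ∞ (K i)]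
    (hKsub : ∀ i, Manifold.IsSmoothEmbedding 𝓘(ℝ, E i) 𝓘(ℝ, E₀) ∞ (Subtype.val : K i → G))
    -- the smooth function on the Lie algebra of `K s`
    (F : LieAlg (E (Fin.last s)) (K (Fin.last s)) → ℝ)
    (hF : ContDiff ℝ ∞ (fun y : E (Fin.last s) => F y)) :
    let H : adjointOrbit Λ → ℝ := fun Z => F (momentMap B (K (Fin.last s)) Z)
    let Φ : ∀ i : Fin s, adjointOrbit Λ → LieAlg (E i.succ) (K i.succ) :=
      fun i Z => momentMap B (K i.succ) Z
    let P : ∀ i : Fin s, adjointOrbit Λ → LieAlg (E i.succ) (K i.succ) :=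
      fun i Z => grad B (K i.succ)
        (fun Y => F (relProj B (K i.succ) (K (Fin.last s)) Y)) (Φ i Z)
    -- the system of Lax equations
    (∀ i : Fin s,
      SmoothOnOrbit (W := E i.succ) (Φ i) Set.univ ∧
      SmoothOnOrbit (W := E i.succ) (P i) Set.univ ∧
      ∀ (γ : ℝ → adjointOrbit Λ) (J : Set ℝ), IsTrajectoryOn B H γ J → ∀ t ∈ J,
        HasDerivAt (fun τ => Φ i (γ τ)) (-⁅Φ i (γ t), P i (γ t)⁆) t) ∧
    -- the matrix Lax equation and the spectrum
    (∀ (V : Fin s → Type*) [∀ i, NormedAddCommGroup (V i)] [∀ i, InnerProductSpace ℂ (V i)]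
      [∀ i, FiniteDimensional ℂ (V i)]
      (ϱ : ∀ i : Fin s, Representation ℂ (K i.succ) (V i)),
      (∀ i, IsIrreducibleUnitary (E := E i.succ) (ϱ i)) →
      ∃ (r : ℕ) (Lϱ Pϱ : adjointOrbit Λ → Matrix (Fin r) (Fin r) ℝ),
        (∃ b : Module.Basis (Fin r) ℝ (∀ i, V i), ∀ Z,
          Lϱ Z = LinearMap.toMatrix b b (directSum fun i => inducedRep (ϱ i) (Φ i Z)) ∧
          Pϱ Z = LinearMap.toMatrix b b (directSum fun i => inducedRep (ϱ i) (P i Z))) ∧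
        (∀ a c, SmoothOnOrbit (fun Z => Lϱ Z a c) Set.univ) ∧
        (∀ a c, SmoothOnOrbit (fun Z => Pϱ Z a c) Set.univ) ∧
        (∀ (γ : ℝ → adjointOrbit Λ) (J : Set ℝ), IsTrajectoryOn B H γ J → ∀ t ∈ J,
          HasDerivAt (fun τ => Lϱ (γ τ)) (-⁅Lϱ (γ t), Pϱ (γ t)⁆) t) ∧
        ∃ (U : Set (adjointOrbit Λ)) (μ : Fin r → adjointOrbit Λ → ℝ),
          IsOpen U ∧ Dense U ∧
          -- the eigenvalues of `Lϱ Z`, with multiplicities, are the `√-1 * μ j Z`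
          (∀ Z ∈ U, ((Lϱ Z).map (algebraMap ℝ ℂ)).charpoly.roots =
            Finset.univ.val.map fun j => Complex.I * (μ j Z : ℂ)) ∧
          (∀ j, SmoothOnOrbit (μ j) U) ∧
          (∀ j, ∀ Z ∈ U, poissonBracket B H (μ j) Z = 0) ∧
          (∀ j l, ∀ Z ∈ U, poissonBracket B (μ j) (μ l) Z = 0)) := by
  intro H Φ P
  have hle (i : Fin s) : K (Fin.last s) ≤ K i.succ := hK (Fin.le_last _)
  have hΦs (i : Fin s) : SmoothOnOrbit (W := E i.succ) (Φ i) Set.univ :=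
    smoothOnOrbit_momentMap hB (hKsub i.succ)
  have hPs (i : Fin s) : SmoothOnOrbit (W := E i.succ) (P i) Set.univ :=
    smoothOnOrbit_grad hB (hKsub i.succ) (hKsub (Fin.last s)) (hle i) hF
  have hLax (i : Fin s) (γ : ℝ → adjointOrbit Λ) (J : Set ℝ) (hγ : IsTrajectoryOn B H γ J)
      (t : ℝ) (ht : t ∈ J) :
      HasDerivAt (fun τ => Φ i (γ τ)) (-⁅Φ i (γ t), P i (γ t)⁆) t :=
    hasDerivAt_momentMap hB (hKsub i.succ) (hKsub (Fin.last s)) (hle i) hF hγ ht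
  refine ⟨fun i => ⟨hΦs i, hPs i, hLax i⟩, ?_⟩
  intro V _ _ _ ϱ hϱ
  -- Here r is twice the sum of the complex dimensions. The same `e` indexes the real basis and the
  -- eigenvalues ±λ.
  let e : (Fin 2 × Σ i : Fin s, Fin (Module.finrank ℂ (V i))) ≃
      Fin (Fintype.card (Fin 2 × Σ i : Fin s, Fin (Module.finrank ℂ (V i)))) :=
    Fintype.equivFin _
  let b : Module.Basis (Fin (Fintype.card (Fin 2 × Σ i : Fin s, Fin (Module.finrank ℂ (V i)))))
      ℝ (∀ i, V i) :=
    (Complex.basisOneI.smulTower (Pi.basis fun i => Module.finBasis ℂ (V i))).reindex e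
  let A : (∀ i : Fin s, E i.succ) →L[ℝ] _ := sumRep (fun i : Fin s => E i.succ) ϱ b
  let M : (∀ i : Fin s, E i.succ) → Matrix _ _ ℝ := sumMat (fun i : Fin s => E i.succ) ϱ b
  have hsmooth (Y : ∀ i : Fin s, adjointOrbit Λ → E i.succ)
      (hY : ∀ i, SmoothOnOrbit (Y i) Set.univ) (a c) :
      SmoothOnOrbit (fun Z => M (fun i => Y i Z) a c) Set.univ :=
    (((ContinuousLinearMap.proj (R := ℝ) (φ := fun _ => ℝ) c).comp
      ((ContinuousLinearMap.proj (R := ℝ) (φ := fun _ => _ → ℝ) a).comp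
        A)).contMDiff.contMDiffOn (s := Set.univ)).comp
      (contMDiffOn_pi_space.mpr hY) fun _ _ => trivial
  refine ⟨_, fun Z => M fun i => Φ i Z, fun Z => M fun i => P i Z,
    ⟨b, fun Z => ⟨rfl, rfl⟩⟩, hsmooth Φ hΦs, hsmooth P hPs, ?_, ?_⟩
  · intro γ J hγ t ht
    refine hasDerivAt_sumMat hϱ b (φ := fun τ i => Φ i (γ τ)) (p := fun τ i => P i (γ τ)) fun i => ?_
    have h := hLax i γ J hγ t ht
    rw [bracket_eq_adL] at h
    exact h
  let ν : (p : Σ i : Fin s, Fin (Module.finrank ℂ (V i))) → adjointOrbit Λ → ℝ :=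
    fun p => orbitEigenvalue B (hϱ p.1) p.2
  -- One pattern for all summands gives a single U; only coincidences within one summand are used
  -- afterwards.
  obtain ⟨U, hUo, hUd, hU⟩ := exists_isOpen_dense_pattern (f := ν) fun p =>
    continuous_orbitEigenvalue (hϱ p.1) p.2
  have hloc (c : ℝ) (p : Σ i : Fin s, Fin (Module.finrank ℂ (V i))) (Z : adjointOrbit Λ)
      (hZ : Z ∈ U) : ∃ g : E p.1.succ → ℝ,
        ContDiffAt ℝ ∞ g (projL (E p.1.succ) (K p.1.succ) B (ptL Z)) ∧
        (fun Z' => c * ν p Z') =ᶠ[nhds Z]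
          fun Z' => g (projL (E p.1.succ) (K p.1.succ) B (ptL Z')) := by
    obtain ⟨g, hg, hg'⟩ := exists_smooth_orbitEigenvalue (B := B) (hϱ p.1) p.2 Z
      ((hU Z hZ).mono fun Z' h b' => h ⟨p.1, b'⟩ p)
    exact ⟨fun x => c * g x, contDiffAt_const.mul hg, hg'.mono fun Z' h => congrArg (c * ·) h⟩
  have hinv (c : ℝ) (p : Σ i : Fin s, Fin (Module.finrank ℂ (V i))) (k : K p.1.succ)
      (Z' : adjointOrbit Λ) : c * ν p (orbitAct (k : G) Z') = c * ν p Z' :=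
    congrArg (c * ·) (orbitEigenvalue_orbitAct (hϱ p.1) hB (hKsub p.1.succ) p.2 k Z')
  refine ⟨U, fun j Z => sgn (e.symm j).1 * ν (e.symm j).2 Z, hUo, hUd, ?_, ?_, ?_, ?_⟩
  · intro Z _
    have hΦ (i : Fin s) : (Φ i Z : E i.succ) = projL (E i.succ) (K i.succ) B (ptL Z) :=
      momentMap_eq hB (hKsub i.succ) Z
    exact (congrArg (fun Y => ((M Y).map (algebraMap ℝ ℂ)).charpoly.roots) (funext hΦ)).trans
      (roots_charpoly_sumMat hϱ b e fun i => projL (E i.succ) (K i.succ) B (ptL Z))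
  · intro j
    refine smoothOnOrbit_of_local fun Z hZ => ?_
    obtain ⟨g, hg, hg'⟩ := hloc (sgn (e.symm j).1) (e.symm j).2 Z hZ
    exact ⟨_, hg.comp _ (projL _ _ B).contDiff.contDiffAt, hg'⟩
  · intro j Z hZ
    obtain ⟨g, hg, hg'⟩ := hloc (sgn (e.symm j).1) (e.symm j).2 Z hZ
    -- H is a function of the moment map of the smallest group of the chain, and μ_j is invariant
    -- under a larger one.
    exact poissonBracket_eq_zero hB (hKsub _) (hKsub (Fin.last s)) (hle _)
      (hF.differentiable (by simp)).differentiableAt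
      (Filter.Eventually.of_forall fun Z' => congrArg F (momentMap_eq hB (hKsub (Fin.last s)) Z'))
      (hg.differentiableAt (by simp)) hg' (hinv _ _)
  · intro j l Z hZ
    obtain ⟨g, hg, hg'⟩ := hloc (sgn (e.symm j).1) (e.symm j).2 Z hZ
    obtain ⟨g₂, hg₂, hg₂'⟩ := hloc (sgn (e.symm l).1) (e.symm l).2 Z hZ
    exact poissonBracket_eq_zero_of_invariant hB (hKsub _) (hKsub _)
      ((le_total _ _).imp (fun h => hK h) fun h => hK h)
      (hg.differentiableAt (by simp)) hg' (hinv _ _)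
      (hg₂.differentiableAt (by simp)) hg₂' (hinv _ _)
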